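/- Let $d\ge 1$, let $\Sigma_p,\Sigma_q$ be symmetric positive definite real $d\times d$ matrices and let $\mu^*\in\mathbb R^d$. The null hypothesis is the Gaussian location family $\mathcal P=\{P_\mu=N(\mu,\Sigma_p):\mu\in\mathbb R^d\}$ and the alternative is the single distribution $Q=N(\mu^*,\Sigma_q)$; $p_\mu$ and $q$ denote their Lebesgue densities. For $n\ge1$ let $U^n=(U_1,\dots,U_n)$ be i.i.d., and write $p_\mu(U^n),q(U^n)$ for the product densities and $P_\mu^{n},Q^{n}$ for the product laws. Define the e-variables $$S^{(n)}_{\mathrm{UI}}=\frac{q(U^n)}{\sup_{\mu\in\mathbb R^d}p_\mu(U^n)},\qquad S^{(n)}_{\mathrm{RIP}}=\frac{q(U^n)}{p_{\leftarrow q}(U^n)},$$ where $p_{\leftarrow q}$ is the density of the reverse information projection of $Q^n$ onto the convex hull $\mathcal C_n=\mathrm{conv}\{P_\mu^n:\mu\in\mathbb R^d\}$, that is, the ($Q^n$-a.e. positive) sub-probability density such that $\log p_k\to\log p_{\leftarrow q}$ in $L^1(Q^n)$ for every sequence $P_k\in\mathcal C_n$ with densities $p_k$ along which the Kullback–Leibler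 divergence $D(Q^n\,\|\,P_k)$ tends to $\inf_{P\in\mathcal C_n}D(Q^n\,\|\,P)<\infty$. Let $\lambda_1,\dots,\lambda_d$ be the eigenvalues of $\Sigma_p^{-1/2}\Sigma_q\Sigma_p^{-1/2}$, let $d_{qp}=\mathrm{tr}(\Sigma_q\Sigma_p^{-1})$, and for positive definite $\Sigma_r$ let $D_{\Sigma_r}(\Sigma_q\|\Sigma_p)=D_{\mathrm{gauss}}(\Sigma_r\Sigma_p^{-1})-D_{\mathrm{gauss}}(\Sigma_r\Sigma_q^{-1})$ with $D_{\mathrm{gauss}}(B)=\tfrac12\bigl(-\log\det B-(d-\mathrm{tr}\,B)\bigr)$. 1. (Strict anti-simple case.) If $\Sigma_q-\Sigma_p$ is positive definite, then for every $n\ge1$ the projection $p_{\leftarrow q}$ exists, $\log\bigl(S^{(n)}_{\mathrm{RIP}}/S^{(n)}_{\mathrm{UI}}\bigr)$ is $Q^n$-integrable, and $$\mathbb E_Q\Bigl[\log\frac{S^{(n)}_{\mathrm{RIP}}}{S^{(n)}_{\mathrm{UI}}}\Bigr]=\frac{d_{qp}}2-D_{\Sigma_q}(\Sigma_q\|\Sigma_p)=\frac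 d2+\frac12\sum_{j=1}^d\log\lambda_j>\frac d2 .$$ 2. (Strict simple case.) If $\Sigma_q-\Sigma_p$ is negative definite, then for every $n\ge1$ the projection $p_{\leftarrow q}$ exists, $\log\bigl(S^{(n)}_{\mathrm{RIP}}/S^{(n)}_{\mathrm{UI}}\bigr)$ is $Q^n$-integrable, and $$\mathbb E_Q\Bigl[\log\frac{S^{(n)}_{\mathrm{RIP}}}{S^{(n)}_{\mathrm{UI}}}\Bigr]=\frac{d_{qp}}2=\frac12\sum_{j=1}^d\lambda_j<\frac d2 .$$ In particular, in both cases the e-power gap does not depend on $n$. -/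

import Mathlib

open MeasureTheory ProbabilityTheory Filter Topology
open scoped NNReal ENNReal Matrix

namespace EPower

section Matrices

variable {d : ℕ}

open scoped MatrixOrder in
/-- The matrix `Σ_p^{-1/2} Σ_q Σ_p^{-1/2}`. -/
noncomputable def whitened (Sp Sq : Matrix (Fin d) (Fin d) ℝ) : Matrix (Fin d) (Fin d) ℝ :=
  (CFC.sqrt Sp)⁻¹ * Sq * (CFC.sqrt Sp)⁻¹

open scoped MatrixOrder in
theorem whitened_isHermitian (Sp : Matrix (Fin d) (Fin d) ℝ) {Sq : Matrix (Fin d) (Fin d) ℝ}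
    (hq : Sq.PosDef) : (whitened Sp Sq).IsHermitian := by
  have h : ((CFC.sqrt Sp)⁻¹).IsHermitian :=
    Matrix.IsHermitian.inv (CFC.sqrt_nonneg Sp).isSelfAdjoint
  have h2 := Matrix.isHermitian_mul_mul_conjTranspose (CFC.sqrt Sp)⁻¹ hq.isHermitian
  rwa [h.eq] at h2

/-- `d_{ab} = tr (Σ_a Σ_b⁻¹)`. -/
noncomputable def effDim (Sa Sb : Matrix (Fin d) (Fin d) ℝ) : ℝ :=
  (Sa * Sb⁻¹).trace

/-- `D_gauss(B) = (1/2) (- log det B - (d - tr B))`. -/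
noncomputable def gaussDiv (B : Matrix (Fin d) (Fin d) ℝ) : ℝ :=
  (1 / 2) * (-Real.log B.det - ((d : ℝ) - B.trace))

/-- `D_{Σ_r}(Σ_q ‖ Σ_p) = D_gauss(Σ_r Σ_p⁻¹) - D_gauss(Σ_r Σ_q⁻¹)`. -/
noncomputable def covDiv (Sr Sq Sp : Matrix (Fin d) (Fin d) ℝ) : ℝ :=
  gaussDiv (Sr * Sp⁻¹) - gaussDiv (Sr * Sq⁻¹)

end Matrices

section RIPr

open InformationTheory

variable {Ω : Type*} [MeasurableSpace Ω]

/-- `g` is (a version of) the density, relative to `ν`, of the reverse information projection of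
the probability measure `Q` onto the set `C` of probability measures: `D(Q ‖ P)` has a finite
infimum over `P ∈ C`, and `g` is the sub-probability density, positive `Q`-almost everywhere, such
that `log p_k → log g` in `L¹(Q)` for every sequence `P_k ∈ C` (with `ν`-densities `p_k`) along
which `D(Q ‖ P_k)` tends to that infimum. The projection need not be an element of `C`. -/
structure IsRIPr (ν Q : Measure Ω) (C : Set (Measure Ω)) (g : Ω → ℝ) : Prop where
  measurable : Measurable g
  nonneg : ∀ u, 0 ≤ g u
  subprob : ∫⁻ u, ENNReal.ofReal (g u) ∂ν ≤ 1
  pos : ∀ᵐ u ∂Q, 0 < g u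
  finite : (⨅ P ∈ C, klDiv Q P) ≠ ∞
  tendsto : ∀ P : ℕ → Measure Ω, (∀ k, P k ∈ C) →
    Tendsto (fun k => klDiv Q (P k)) atTop (𝓝 (⨅ P ∈ C, klDiv Q P)) →
    Tendsto (fun k => ∫⁻ u, ‖Real.log ((P k).rnDeriv ν u).toReal - Real.log (g u)‖ₑ ∂Q)
      atTop (𝓝 0)

end RIPr

section Gaussian

variable {d : ℕ}

/-- The law of `n` i.i.d. outcomes with distribution `N(m, S)`. -/
noncomputable def gaussSample (n : ℕ) (m : EuclideanSpace ℝ (Fin d))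
    (S : Matrix (Fin d) (Fin d) ℝ) : Measure (Fin n → EuclideanSpace ℝ (Fin d)) :=
  Measure.pi fun _ => multivariateGaussian m S

/-- The Lebesgue density of `N(m, S)`, for positive definite `S`. -/
noncomputable def gaussPDF (m : EuclideanSpace ℝ (Fin d)) (S : Matrix (Fin d) (Fin d) ℝ)
    (x : EuclideanSpace ℝ (Fin d)) : ℝ :=
  (√((2 * Real.pi) ^ d * S.det))⁻¹ *
    Real.exp (-((x - m).ofLp ⬝ᵥ S⁻¹ *ᵥ (x - m).ofLp) / 2)

/-- The density of `n` i.i.d. outcomes with distribution `N(m, S)`. -/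
noncomputable def samplePDF {n : ℕ} (m : EuclideanSpace ℝ (Fin d))
    (S : Matrix (Fin d) (Fin d) ℝ) (u : Fin n → EuclideanSpace ℝ (Fin d)) : ℝ :=
  ∏ i, gaussPDF m S (u i)

/-- The null hypothesis at sample size `n`: the Gaussian location family with covariance `Sp`. -/
def nullFamily (n : ℕ) (Sp : Matrix (Fin d) (Fin d) ℝ) :
    Set (Measure (Fin n → EuclideanSpace ℝ (Fin d))) :=
  Set.range fun m : EuclideanSpace ℝ (Fin d) => gaussSample n m Sp

/-- `g` is the density of the reverse information projection of `N(m, Sq)^n` onto the convex hull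
of the null hypothesis at sample size `n`. -/
def IsGaussRIPr (n : ℕ) (m : EuclideanSpace ℝ (Fin d)) (Sp Sq : Matrix (Fin d) (Fin d) ℝ)
    (g : (Fin n → EuclideanSpace ℝ (Fin d)) → ℝ) : Prop :=
  IsRIPr volume (gaussSample n m Sq) (convexHull ℝ≥0 (nullFamily n Sp)) g

/-- The RIPr e-variable `q(U^n) / g(U^n)`, where `g` is the density of the projection. -/
noncomputable def ripVar {n : ℕ} (m : EuclideanSpace ℝ (Fin d)) (Sq : Matrix (Fin d) (Fin d) ℝ)
    (g : (Fin n → EuclideanSpace ℝ (Fin d)) → ℝ) (u : Fin n → EuclideanSpace ℝ (Fin d)) : ℝ :=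
  samplePDF m Sq u / g u

/-- The universal inference e-variable `q(U^n) / sup_μ p_μ(U^n)`. -/
noncomputable def uiVar {n : ℕ} (m : EuclideanSpace ℝ (Fin d))
    (Sp Sq : Matrix (Fin d) (Fin d) ℝ) (u : Fin n → EuclideanSpace ℝ (Fin d)) : ℝ :=
  samplePDF m Sq u / ⨆ m' : EuclideanSpace ℝ (Fin d), samplePDF m' Sp u

/-- The reverse information projection exists at sample size `n`, and
`E_Q [log (S_RIP / S_UI)]` is well defined and equal to `c`. -/
def EPowerGapEq (n : ℕ) (m : EuclideanSpace ℝ (Fin d)) (Sp Sq : Matrix (Fin d) (Fin d) ℝ)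
    (c : ℝ) : Prop :=
  (∃ g, IsGaussRIPr n m Sp Sq g) ∧
  ∀ g, IsGaussRIPr n m Sp Sq g →
    Integrable (fun u => Real.log (ripVar m Sq g u / uiVar m Sp Sq u)) (gaussSample n m Sq) ∧
    ∫ u, Real.log (ripVar m Sq g u / uiVar m Sp Sq u) ∂(gaussSample n m Sq) = c

end Gaussian

end EPower

/-! Everything reduces to the sample mean `ū`. It is sufficient for the location family, so `p_μ(u)
= N(μ, Σ_p/n)(ū) · R(u)` with one factor `R` for all `μ` (`exists_samplePDF_eq_mul`), and under
`Q^n` it has law `N(μ*, Σ_q/n)`. The projection is sought as `g(u) = N(μ*, S₀)(ū) · R(u)`.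

Optimality is certified by `isRIPr_of_dominated`. If `E_Q[p/g] ≤ 1` for every null density `p`,
hence for every mixture, then Jensen gives `E_Q[log (g/p)] ≥ 0`, so no `P` in the hull has smaller
divergence than `g`. If members of the hull also come arbitrarily close, `g` attains the infimum;
the same inequality in quantitative form (`integral_abs_log_le`) makes the log-densities of every
minimising sequence converge in `L¹(Q)`.

If `Σ_q > Σ_p`, take `S₀ = Σ_q/n`. Mixing `N(z, Σ_p/n)` over `z ~ N(μ*, (Σ_q - Σ_p)/n)` gives
exactly the law of `ū` under `Q^n`, so the expected ratios equal 1. This mixture is continuous,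
whereas the hull contains finite mixtures only; it is discretised and the limit taken by dominated
convergence (`tendsto_integral_log_approxMix`). If `Σ_q < Σ_p`, take `S₀ = Σ_p/n`, so that `g =
p_{μ*}` is in the null; the ratios `p_μ/p_{μ*}` are exponentials of affine functions, and a Gaussian
moment generating function bounds their mean by 1.

In `S_RIP/S_UI` both `q` and `R` cancel. As the supremum over `μ` is attained at `ū`, what remains
is a log-determinant difference plus half a quadratic form in `ū - μ*`, of mean `tr(Σ_q/n ·
S₀⁻¹)/2`. Since `S₀` scales like `1/n`, the sample size drops out. -/

namespace EPower

/-! ### A sufficient criterion for the reverse information projection -/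

section Criterion

open InformationTheory

variable {Ω : Type*} [MeasurableSpace Ω]

/-- When `x = s² ≥ 1`, `2 log x ≤ 4 (s - 1)`, the AM-GM inequality with weight `δ` brings in `(s -
1)²`, and `(s - 1)² ≤ x - 1 - log x`. For `x` of mean at most 1, the last term has mean at most
`-(2/δ) E[log x]`, so a small `-E[log x]` forces a small `E|log x|`. -/
theorem abs_log_le {x δ : ℝ} (hx : 0 < x) (hδ : 0 < δ) :
    |Real.log x| ≤ -Real.log x + 2 * δ + 2 / δ * (x - 1 - Real.log x) := by
  have h0 : 0 ≤ x - 1 - Real.log x := by linarith [Real.log_le_sub_one_of_pos hx]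
  have h1 : 0 ≤ 2 / δ * (x - 1 - Real.log x) := by positivity
  rcases le_total (Real.log x) 0 with h | h
  · rw [abs_of_nonpos h]; linarith
  · rw [abs_of_nonneg h]
    obtain ⟨s, hs, rfl⟩ : ∃ s : ℝ, 0 < s ∧ x = s ^ 2 :=
      ⟨√x, Real.sqrt_pos.2 hx, (Real.sq_sqrt hx.le).symm⟩
    have h2 : Real.log (s ^ 2) ≤ 2 * (s - 1) := by
      rw [Real.log_pow]; push_cast; linarith [Real.log_le_sub_one_of_pos hs]
    have h3 : 2 / δ * (s - 1) ^ 2 ≤ 2 / δ * (s ^ 2 - 1 - Real.log (s ^ 2)) := by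
      gcongr; nlinarith
    have h4 : 4 * (s - 1) ≤ 2 * δ + 2 / δ * (s - 1) ^ 2 := by
      have : 2 * δ + 2 / δ * (s - 1) ^ 2 - 4 * (s - 1) = 2 / δ * (s - 1 - δ) ^ 2 := by
        field_simp; ring
      nlinarith [show 0 ≤ 2 / δ * (s - 1 - δ) ^ 2 by positivity]
    linarith

variable {ν Q : Measure Ω}

theorem integrable_of_lintegral_ofReal_le_one {f : Ω → ℝ} (hf : Measurable f) (h0 : ∀ u, 0 < f u)
    (h1 : ∫⁻ u, ENNReal.ofReal (f u) ∂Q ≤ 1) : Integrable f Q ∧ ∫ u, f u ∂Q ≤ 1 := by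
  have hI : Integrable f Q := by
    refine ⟨hf.aestronglyMeasurable, ?_⟩
    rw [hasFiniteIntegral_iff_ofReal (Eventually.of_forall fun u => (h0 u).le)]
    exact h1.trans_lt ENNReal.one_lt_top
  refine ⟨hI, ?_⟩
  rw [integral_eq_lintegral_of_nonneg_ae (Eventually.of_forall fun u => (h0 u).le)
    hf.aestronglyMeasurable]
  exact ENNReal.toReal_le_of_le_ofReal zero_le_one (by simpa using h1)

theorem integral_neg_log_nonneg [IsProbabilityMeasure Q] {f : Ω → ℝ} (hf : Measurable f)
    (h0 : ∀ u, 0 < f u) (h1 : ∫⁻ u, ENNReal.ofReal (f u) ∂Q ≤ 1)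
    (hl : Integrable (fun u => Real.log (f u)) Q) : 0 ≤ ∫ u, -Real.log (f u) ∂Q := by
  obtain ⟨hI, hle⟩ := integrable_of_lintegral_ofReal_le_one hf h0 h1
  have h := integral_mono hl (hI.sub (integrable_const 1))
    (fun u => Real.log_le_sub_one_of_pos (h0 u))
  simp only [Pi.sub_apply] at h
  rw [integral_sub hI (integrable_const _)] at h
  simp at h
  rw [integral_neg]; linarith

theorem integral_abs_log_le [IsProbabilityMeasure Q] {f : Ω → ℝ} (hf : Measurable f)
    (h0 : ∀ u, 0 < f u) (h1 : ∫⁻ u, ENNReal.ofReal (f u) ∂Q ≤ 1)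
    (hl : Integrable (fun u => Real.log (f u)) Q) {δ : ℝ} (hδ : 0 < δ) :
    ∫ u, |Real.log (f u)| ∂Q ≤ 2 * δ + (1 + 2 / δ) * ∫ u, -Real.log (f u) ∂Q := by
  obtain ⟨hI, hle⟩ := integrable_of_lintegral_ofReal_le_one hf h0 h1
  have h := integral_mono (μ := Q) hl.abs
    (g := fun u => (-Real.log (f u) + 2 * δ) + 2 / δ * (f u - 1 - Real.log (f u)))
    ((hl.neg.add (integrable_const _)).add (((hI.sub (integrable_const 1)).sub hl).const_mul _))
    (fun u => abs_log_le (h0 u) hδ)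
  have e1 : ∫ u, (-Real.log (f u) + 2 * δ) + 2 / δ * (f u - 1 - Real.log (f u)) ∂Q =
      ∫ u, (-Real.log (f u) + 2 * δ) ∂Q + ∫ u, 2 / δ * (f u - 1 - Real.log (f u)) ∂Q :=
    integral_add (hl.neg.add (integrable_const _))
      (((hI.sub (integrable_const 1)).sub hl).const_mul _)
  have e2 : ∫ u, (-Real.log (f u) + 2 * δ) ∂Q = ∫ u, -Real.log (f u) ∂Q + ∫ _, 2 * δ ∂Q :=
    integral_add hl.neg (integrable_const _)
  have e3 : ∫ u, (f u - 1 - Real.log (f u)) ∂Q =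
      ∫ u, (f u - 1) ∂Q - ∫ u, Real.log (f u) ∂Q := integral_sub (hI.sub (integrable_const 1)) hl
  have e4 : ∫ u, 2 / δ * (f u - 1 - Real.log (f u)) ∂Q =
      2 / δ * ∫ u, (f u - 1 - Real.log (f u)) ∂Q := integral_const_mul _ _
  rw [e1, e2, e4, e3, integral_sub hI (integrable_const _)] at h
  simp only [integral_const, probReal_univ, smul_eq_mul, one_mul, integral_neg] at h ⊢
  have : 2 / δ * (∫ u, f u ∂Q - 1 - ∫ u, Real.log (f u) ∂Q) ≤
      2 / δ * -∫ u, Real.log (f u) ∂Q := by gcongr; linarith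
  linarith

theorem tendsto_integral_abs_log [IsProbabilityMeasure Q] {f : ℕ → Ω → ℝ}
    (hf : ∀ k, Measurable (f k)) (h0 : ∀ k u, 0 < f k u)
    (h1 : ∀ k, ∫⁻ u, ENNReal.ofReal (f k u) ∂Q ≤ 1)
    (hl : ∀ k, Integrable (fun u => Real.log (f k u)) Q)
    (ht : Tendsto (fun k => ∫ u, -Real.log (f k u) ∂Q) atTop (𝓝 0)) :
    Tendsto (fun k => ∫ u, |Real.log (f k u)| ∂Q) atTop (𝓝 0) := by
  rw [Metric.tendsto_nhds]
  intro η hη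
  -- With `δ = η / 4` the constant term `2 * δ` uses up `η / 2`, leaving `η / 2` for the vanishing
  -- term.
  have h2 := ht.const_mul (1 + 2 / (η / 4))
  rw [mul_zero] at h2
  filter_upwards [h2.eventually (gt_mem_nhds (half_pos hη))] with k hk
  rw [Real.dist_0_eq_abs, abs_of_nonneg (integral_nonneg fun u => abs_nonneg _)]
  have := integral_abs_log_le (hf k) (h0 k) (h1 k) (hl k) (show 0 < η / 4 by positivity)
  linarith

/-- `P` is a probability measure with a positive `ν`-density `p` such that `log p` is
`Q`-integrable and `E_Q[p / g] ≤ 1`. -/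
structure HasDominatedDensity (ν Q : Measure Ω) (g : Ω → ℝ) (P : Measure Ω) (p : Ω → ℝ) :
    Prop where
  measurable : Measurable p
  pos : ∀ u, 0 < p u
  eq_withDensity : P = ν.withDensity fun u => ENNReal.ofReal (p u)
  prob : P Set.univ = 1
  integrable_log : Integrable (fun u => Real.log (p u)) Q
  lintegral_div_le : ∫⁻ u, ENNReal.ofReal (p u / g u) ∂Q ≤ 1

theorem abs_log_convexCombo_le {a b x y : ℝ} (ha : 0 ≤ a) (hb : 0 ≤ b) (hab : a + b = 1)
    (hx : 0 < x) (hy : 0 < y) :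
    |Real.log (a * x + b * y)| ≤ |Real.log x| + |Real.log y| := by
  have h1 : min x y ≤ a * x + b * y := by
    have := min_le_left x y; have := min_le_right x y
    calc min x y = a * min x y + b * min x y := by rw [← add_mul, hab, one_mul]
      _ ≤ _ := by gcongr
  have h2 : a * x + b * y ≤ max x y := by
    have := le_max_left x y; have := le_max_right x y
    calc a * x + b * y ≤ a * max x y + b * max x y := by gcongr
      _ = max x y := by rw [← add_mul, hab, one_mul]
  have hm : 0 < min x y := lt_min hx hy
  have h3 := Real.log_le_log hm h1
  have h4 := Real.log_le_log (hm.trans_le h1) h2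
  have := neg_abs_le (Real.log x); have := neg_abs_le (Real.log y)
  have := le_abs_self (Real.log x); have := le_abs_self (Real.log y)
  have := abs_nonneg (Real.log x); have := abs_nonneg (Real.log y)
  rw [abs_le]
  constructor
  · rcases min_choice x y with h | h <;> rw [h] at h3 <;> linarith
  · rcases max_choice x y with h | h <;> rw [h] at h4 <;> linarith

/-- Convexity is stated for pairs, so that a finite mixture comes with its explicit density and not
merely with some density. -/
theorem convex_hasDominatedDensity {g : Ω → ℝ} (hg : Measurable g) (hg0 : ∀ u, 0 < g u) :
    Convex ℝ≥0 {P : Measure Ω × (Ω → ℝ) | HasDominatedDensity ν Q g P.1 P.2} := by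
  rintro ⟨P, p⟩ (hp : HasDominatedDensity ν Q g P p) ⟨P', p'⟩
    (hp' : HasDominatedDensity ν Q g P' p') a b - - hab
  have habR : (a : ℝ) + b = 1 := by exact_mod_cast congrArg NNReal.toReal hab
  have habE : (a : ℝ≥0∞) + b = 1 := by exact_mod_cast hab
  have hsplit : ∀ x y : ℝ, 0 ≤ x → 0 ≤ y → ENNReal.ofReal (a * x + b * y) =
      a * ENNReal.ofReal x + b * ENNReal.ofReal y := by
    intro x y hx hy
    rw [ENNReal.ofReal_add (by positivity) (by positivity), ENNReal.ofReal_mul a.coe_nonneg,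
      ENNReal.ofReal_mul b.coe_nonneg, ENNReal.ofReal_coe_nnreal, ENNReal.ofReal_coe_nnreal]
  have hmp := hp.measurable
  have hmp' := hp'.measurable
  have hpos : ∀ u, 0 < a * p u + b * p' u := by
    intro u
    rcases a.coe_nonneg.lt_or_eq with h | h
    · have := mul_pos h (hp.pos u)
      have := mul_nonneg b.coe_nonneg (hp'.pos u).le
      linarith
    · rw [← h, zero_add] at habR
      rw [← h, habR]; simpa using hp'.pos u
  change HasDominatedDensity ν Q g (a • P + b • P') (fun u => a * p u + b * p' u)
  refine ⟨by fun_prop, hpos, ?_, ?_, ?_, ?_⟩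
  · have : (fun u => ENNReal.ofReal (a * p u + b * p' u)) =
        (a : ℝ≥0∞) • (fun u => ENNReal.ofReal (p u)) +
          (b : ℝ≥0∞) • fun u => ENNReal.ofReal (p' u) := by
      ext u; simp [hsplit _ _ (hp.pos u).le (hp'.pos u).le]
    rw [this, withDensity_add_left (by fun_prop), withDensity_smul _ (by fun_prop),
      withDensity_smul _ (by fun_prop), ← hp.eq_withDensity, ← hp'.eq_withDensity]
    rfl
  · rw [Measure.add_apply, Measure.smul_apply, Measure.smul_apply, hp.prob, hp'.prob]
    simpa [ENNReal.smul_def] using habE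
  · refine (hp.integrable_log.abs.add hp'.integrable_log.abs).mono'
      (Measurable.log (by fun_prop)).aestronglyMeasurable (Eventually.of_forall fun u => ?_)
    exact abs_log_convexCombo_le a.coe_nonneg b.coe_nonneg habR (hp.pos u) (hp'.pos u)
  · have : (fun u => ENNReal.ofReal ((a * p u + b * p' u) / g u)) =
        fun u => a * ENNReal.ofReal (p u / g u) + b * ENNReal.ofReal (p' u / g u) := by
      ext u
      rw [← hsplit _ _ (div_pos (hp.pos u) (hg0 u)).le (div_pos (hp'.pos u) (hg0 u)).le]
      ring_nf
    rw [this, lintegral_add_left (by fun_prop), lintegral_const_mul _ (by fun_prop),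
      lintegral_const_mul _ (by fun_prop)]
    calc _ ≤ (a : ℝ≥0∞) * 1 + b * 1 := by
          gcongr
          · exact hp.lintegral_div_le
          · exact hp'.lintegral_div_le
      _ = 1 := by simpa using habE

theorem exists_hasDominatedDensity_of_mem_convexHull {C : Set (Measure Ω)} {g : Ω → ℝ}
    (hg : Measurable g) (hg0 : ∀ u, 0 < g u) (hC : ∀ P ∈ C, ∃ p, HasDominatedDensity ν Q g P p)
    {P : Measure Ω} (hP : P ∈ convexHull ℝ≥0 C) : ∃ p, HasDominatedDensity ν Q g P p := by
  refine convexHull_min (t := {P : Measure Ω | ∃ p, HasDominatedDensity ν Q g P p}) hC ?_ hP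
  rintro P ⟨p, hp⟩ P' ⟨p', hp'⟩ a b ha hb hab
  exact ⟨_, convex_hasDominatedDensity hg hg0 (x := (P, p)) hp (y := (P', p')) hp' ha hb hab⟩

/-- Splitting off one point, the remaining weights are renormalised by their sum; if that sum is
zero, the split-off point has weight one. No subtraction is needed, so this applies to measures. -/
theorem convex_nnreal_sum_mem {V ι : Type*} [AddCommMonoid V] [Module ℝ≥0 V] {s : Set V}
    (hs : Convex ℝ≥0 s) (t : Finset ι) (w : ι → ℝ≥0) (z : ι → V) (hw : ∑ i ∈ t, w i = 1)
    (hz : ∀ i ∈ t, z i ∈ s) : ∑ i ∈ t, w i • z i ∈ s := by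
  classical
  induction t using Finset.induction generalizing w with
  | empty => simp at hw
  | insert a t ha ih =>
    rw [Finset.sum_insert ha] at hw ⊢
    have hza := hz a (Finset.mem_insert_self a t)
    have hzt : ∀ i ∈ t, z i ∈ s := fun i hi => hz i (Finset.mem_insert_of_mem hi)
    rcases eq_or_ne (∑ i ∈ t, w i) 0 with h0 | h0
    · have h1 : ∀ i ∈ t, w i = 0 := Finset.sum_eq_zero_iff.1 h0
      rw [Finset.sum_eq_zero fun i hi => by rw [h1 i hi, zero_smul], add_zero]
      rw [h0, add_zero] at hw
      rwa [hw, one_smul]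
    · have h2 := ih (fun i => w i / ∑ j ∈ t, w j) (by rw [← Finset.sum_div, div_self h0]) hzt
      have h3 := hs hza h2 zero_le zero_le hw
      simp only [Finset.smul_sum, smul_smul, mul_div_cancel₀ _ h0] at h3
      exact h3

theorem klDiv_eq_of_density [IsProbabilityMeasure Q] [SigmaFinite ν] {q p : Ω → ℝ}
    {P : Measure Ω} (hq : Measurable q)
    (hQ : Q = ν.withDensity fun u => ENNReal.ofReal (q u)) (hq0 : ∀ u, 0 < q u)
    (hql : Integrable (fun u => Real.log (q u)) Q)
    {g : Ω → ℝ} (hp : HasDominatedDensity ν Q g P p) :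
    klDiv Q P = ENNReal.ofReal (∫ u, Real.log (q u) - Real.log (p u) ∂Q) := by
  have hmp := hp.measurable
  have hPp : IsProbabilityMeasure P := ⟨hp.prob⟩
  have hQP : Q = P.withDensity fun u => ENNReal.ofReal (q u / p u) := by
    rw [hp.eq_withDensity, ← withDensity_mul _ (by fun_prop) (by fun_prop), hQ]
    congr 1
    ext u
    rw [Pi.mul_apply, ← ENNReal.ofReal_mul (hp.pos u).le, mul_div_cancel₀ _ (hp.pos u).ne']
  have hac : Q ≪ P := by rw [hQP]; exact withDensity_absolutelyContinuous _ _
  have hllr : llr Q P =ᵐ[Q] fun u => Real.log (q u) - Real.log (p u) := by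
    have h := hac.ae_le (Measure.rnDeriv_withDensity P
      (f := fun u => ENNReal.ofReal (q u / p u)) (by fun_prop))
    rw [← hQP] at h
    filter_upwards [h] with u hu
    rw [llr, hu, ENNReal.toReal_ofReal (div_pos (hq0 u) (hp.pos u)).le,
      Real.log_div (hq0 u).ne' (hp.pos u).ne']
  have hI : Integrable (llr Q P) Q := (hql.sub hp.integrable_log).congr hllr.symm
  -- The total-mass correction in `klDiv` vanishes, since `Q` and `P` both have mass one.
  rw [klDiv_of_ac_of_integrable hac hI, integral_congr_ae hllr]
  simp

theorem HasDominatedDensity.integral_log_sub_nonneg [IsProbabilityMeasure Q] {g p : Ω → ℝ}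
    {P : Measure Ω} (hg : Measurable g) (hg0 : ∀ u, 0 < g u)
    (hgl : Integrable (fun u => Real.log (g u)) Q) (hp : HasDominatedDensity ν Q g P p) :
    0 ≤ ∫ u, Real.log (g u) - Real.log (p u) ∂Q := by
  have hmp := hp.measurable
  have h : ∀ u, Real.log (p u / g u) = Real.log (p u) - Real.log (g u) :=
    fun u => Real.log_div (hp.pos u).ne' (hg0 u).ne'
  have := integral_neg_log_nonneg (f := fun u => p u / g u) (by fun_prop)
    (fun u => div_pos (hp.pos u) (hg0 u)) hp.lintegral_div_le
    (by simp only [h]; exact hp.integrable_log.sub hgl)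
  simpa only [h, neg_sub] using this

/-- A sub-probability density `g` with `E_Q[p / g] ≤ 1` for all densities `p` of members of `C`
is the reverse information projection as soon as its divergence can be approached within `C`. -/
theorem isRIPr_of_dominated [IsProbabilityMeasure Q] [SigmaFinite ν] {C : Set (Measure Ω)}
    {q g : Ω → ℝ} (hq : Measurable q) (hq0 : ∀ u, 0 < q u)
    (hQ : Q = ν.withDensity fun u => ENNReal.ofReal (q u))
    (hql : Integrable (fun u => Real.log (q u)) Q)
    (hg : Measurable g) (hg0 : ∀ u, 0 < g u) (hg1 : ∫⁻ u, ENNReal.ofReal (g u) ∂ν ≤ 1)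
    (hgl : Integrable (fun u => Real.log (g u)) Q)
    (hC : ∀ P ∈ C, ∃ p, HasDominatedDensity ν Q g P p)
    (happ : ∃ P : ℕ → Measure Ω, ∃ p : ℕ → Ω → ℝ, (∀ k, P k ∈ C) ∧
      (∀ k, HasDominatedDensity ν Q g (P k) (p k)) ∧
      Tendsto (fun k => ∫ u, Real.log (g u) - Real.log (p k u) ∂Q) atTop (𝓝 0)) :
    IsRIPr ν Q C g ∧ ∃ P : ℕ → Measure Ω, (∀ k, P k ∈ C) ∧
      Tendsto (fun k => klDiv Q (P k)) atTop (𝓝 (⨅ P ∈ C, klDiv Q P)) := by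
  set D := ∫ u, Real.log (q u) - Real.log (g u) ∂Q with hD
  -- Pythagorean split: the divergence of `P` is that of `g` plus an excess `E_Q[log (g/p)]`, which
  -- the domination hypothesis makes nonnegative.
  have hkl : ∀ P p, HasDominatedDensity ν Q g P p →
      klDiv Q P = ENNReal.ofReal (D + ∫ u, Real.log (g u) - Real.log (p u) ∂Q) := by
    intro P p hp
    have h := integral_add (hql.sub hgl) (hgl.sub hp.integrable_log)
    simp only [Pi.sub_apply, sub_add_sub_cancel] at h
    rw [klDiv_eq_of_density hq hQ hq0 hql hp, hD, h]
  -- Without this sign, `ENNReal.ofReal` would truncate and the excess could not be recovered from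
  -- convergence of `klDiv`.
  have hD0 : 0 ≤ D := by
    have h : ∀ u, Real.log (g u / q u) = Real.log (g u) - Real.log (q u) :=
      fun u => Real.log_div (hg0 u).ne' (hq0 u).ne'
    have h1 : ∫⁻ u, ENNReal.ofReal (g u / q u) ∂Q ≤ 1 := by
      rw [hQ, lintegral_withDensity_eq_lintegral_mul _ (by fun_prop) (by fun_prop)]
      refine le_trans (le_of_eq ?_) hg1
      congr 1
      ext u
      rw [Pi.mul_apply, ← ENNReal.ofReal_mul (hq0 u).le, mul_div_cancel₀ _ (hq0 u).ne']
    have := integral_neg_log_nonneg (f := fun u => g u / q u) (by fun_prop)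
      (fun u => div_pos (hg0 u) (hq0 u)) h1 (by simp only [h]; exact hgl.sub hql)
    simpa only [h, neg_sub] using this
  obtain ⟨P, p, hPC, hPp, hPt⟩ := happ
  have hPkl : Tendsto (fun k => klDiv Q (P k)) atTop (𝓝 (ENNReal.ofReal D)) := by
    simp_rw [fun k => hkl _ _ (hPp k)]
    refine ENNReal.tendsto_ofReal ?_
    simpa using hPt.const_add D
  have hinf : (⨅ P ∈ C, klDiv Q P) = ENNReal.ofReal D := by
    refine le_antisymm (ge_of_tendsto' hPkl fun k => iInf₂_le _ (hPC k)) ?_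
    refine le_iInf₂ fun P' hP' => ?_
    obtain ⟨p', hp'⟩ := hC P' hP'
    rw [hkl _ _ hp']
    exact ENNReal.ofReal_le_ofReal
      (le_add_of_nonneg_right (hp'.integral_log_sub_nonneg hg hg0 hgl))
  refine ⟨⟨hg, fun u => (hg0 u).le, hg1, Eventually.of_forall hg0,
    by rw [hinf]; exact ENNReal.ofReal_ne_top, ?_⟩, P, hPC, by rwa [hinf]⟩
  -- Along any minimising sequence the excess tends to zero, so `tendsto_integral_abs_log` applies
  -- to the ratios `r k / g`.
  intro R hRC hRt
  rw [hinf] at hRt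
  choose r hr using fun k => hC _ (hRC k)
  have hr_meas := fun k => (hr k).measurable
  have hlog : ∀ k u, Real.log (r k u / g u) = Real.log (r k u) - Real.log (g u) :=
    fun k u => Real.log_div ((hr k).pos u).ne' (hg0 u).ne'
  have ht : Tendsto (fun k => ∫ u, Real.log (g u) - Real.log (r k u) ∂Q) atTop (𝓝 0) := by
    have h := (ENNReal.tendsto_toReal ENNReal.ofReal_ne_top).comp hRt
    rw [ENNReal.toReal_ofReal hD0] at h
    have h2 := h.sub_const D
    rw [sub_self] at h2
    refine h2.congr fun k => ?_
    rw [Function.comp_apply, hkl _ _ (hr k), ENNReal.toReal_ofReal]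
    · ring
    · exact add_nonneg hD0 ((hr k).integral_log_sub_nonneg hg hg0 hgl)
  have habs := tendsto_integral_abs_log (Q := Q) (f := fun k u => r k u / g u)
    (fun k => (hr_meas k).div hg) (fun k u => div_pos ((hr k).pos u) (hg0 u))
    (fun k => (hr k).lintegral_div_le)
    (fun k => by simp only [hlog]; exact (hr k).integrable_log.sub hgl)
    (by simpa only [hlog, neg_sub] using ht)
  have hQν : Q ≪ ν := by rw [hQ]; exact withDensity_absolutelyContinuous _ _
  have hE := ENNReal.tendsto_ofReal habs
  rw [ENNReal.ofReal_zero] at hE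
  refine hE.congr fun k => ?_
  rw [ofReal_integral_eq_lintegral_ofReal
    (by simp only [hlog]; exact ((hr k).integrable_log.sub hgl).abs)
    (Eventually.of_forall fun u => abs_nonneg _)]
  refine lintegral_congr_ae ?_
  have hrn := hQν.ae_le (Measure.rnDeriv_withDensity ν
    (f := fun u => ENNReal.ofReal (r k u)) (hr_meas k).ennreal_ofReal)
  rw [← (hr k).eq_withDensity] at hrn
  filter_upwards [hrn] with u hu
  rw [hu, ENNReal.toReal_ofReal ((hr k).pos u).le, hlog, ← Real.norm_eq_abs, ofReal_norm]

/-- The log-densities of one minimising sequence converge in `L¹(Q)` to both `log g` and `log g'`.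
Hence the gap can be computed from any version of the projection. -/
theorem IsRIPr.ae_eq {C : Set (Measure Ω)} {g g' : Ω → ℝ} (h : IsRIPr ν Q C g)
    (h' : IsRIPr ν Q C g') {P : ℕ → Measure Ω} (hP : ∀ k, P k ∈ C)
    (ht : Tendsto (fun k => klDiv Q (P k)) atTop (𝓝 (⨅ P ∈ C, klDiv Q P))) :
    g =ᵐ[Q] g' := by
  have hm := h.measurable
  have hm' := h'.measurable
  have h1 := h.tendsto P hP ht
  have h2 := h'.tendsto P hP ht
  have h3 := h1.add h2
  rw [add_zero] at h3
  have h0 : ∫⁻ u, ‖Real.log (g u) - Real.log (g' u)‖ₑ ∂Q = 0 := by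
    refine le_antisymm (ge_of_tendsto' h3 fun k => ?_) bot_le
    rw [← lintegral_add_left (by fun_prop)]
    refine lintegral_mono fun u => ?_
    calc ‖Real.log (g u) - Real.log (g' u)‖ₑ
        = ‖(Real.log ((P k).rnDeriv ν u).toReal - Real.log (g' u)) -
            (Real.log ((P k).rnDeriv ν u).toReal - Real.log (g u))‖ₑ := by congr 1; ring
      _ ≤ _ := by rw [add_comm]; exact enorm_sub_le
  rw [lintegral_eq_zero_iff (by fun_prop)] at h0
  filter_upwards [h0, h.pos, h'.pos] with u hu hp hp'
  have : Real.log (g u) = Real.log (g' u) := by simpa [sub_eq_zero] using hu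
  exact Real.log_injOn_pos hp hp' this

end Criterion

/-! ### Lebesgue densities of Gaussian laws and of their products -/

section Density

theorem pi_withDensity_ofReal {ι : Type*} [Fintype ι] {X : ι → Type*}
    [∀ i, MeasurableSpace (X i)] (μ : ∀ i, Measure (X i)) [∀ i, SigmaFinite (μ i)]
    {f : ∀ i, X i → ℝ} (h0 : ∀ i x, 0 ≤ f i x)
    (hI : ∀ i, Integrable (f i) (μ i)) :
    Measure.pi (fun i => (μ i).withDensity fun x => ENNReal.ofReal (f i x)) =
      (Measure.pi μ).withDensity fun x => ENNReal.ofReal (∏ i, f i (x i)) := by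
  have : ∀ i, SigmaFinite ((μ i).withDensity fun x => ENNReal.ofReal (f i x)) :=
    fun i => SigmaFinite.withDensity_ofReal _
  refine Measure.pi_eq fun s hs => ?_
  have hpi : MeasurableSet (Set.univ.pi s) := MeasurableSet.univ_pi hs
  have hind : ∀ x : ∀ i, X i, (Set.univ.pi s).indicator (fun x => ∏ i, f i (x i)) x =
      ∏ i, (s i).indicator (f i) (x i) := by
    intro x
    by_cases hx : x ∈ Set.univ.pi s
    · rw [Set.indicator_of_mem hx]
      exact Finset.prod_congr rfl fun i _ => (Set.indicator_of_mem (hx i trivial) _).symm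
    · rw [Set.indicator_of_notMem hx]
      obtain ⟨i, hi⟩ : ∃ i, x i ∉ s i := by simpa [Set.mem_pi] using hx
      exact (Finset.prod_eq_zero (Finset.mem_univ i) (Set.indicator_of_notMem hi _)).symm
  have hIp : Integrable (fun x : ∀ i, X i => ∏ i, f i (x i)) (Measure.pi μ) :=
    Integrable.fintype_prod_dep hI
  have hR : ∀ i, ∫⁻ x in s i, ENNReal.ofReal (f i x) ∂μ i =
      ENNReal.ofReal (∫ x, (s i).indicator (f i) x ∂μ i) := by
    intro i
    rw [integral_indicator (hs i), ofReal_integral_eq_lintegral_ofReal (hI i).integrableOn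
      (Eventually.of_forall (h0 i))]
  rw [withDensity_apply _ hpi, ← ofReal_integral_eq_lintegral_ofReal hIp.integrableOn
    (Eventually.of_forall fun x => Finset.prod_nonneg fun i _ => h0 i _), ← integral_indicator hpi]
  simp_rw [hind]
  rw [integral_fintype_prod_eq_prod, ENNReal.ofReal_prod_of_nonneg]
  · exact Finset.prod_congr rfl fun i _ => by rw [withDensity_apply _ (hs i), hR]
  · exact fun i _ => integral_nonneg fun x => Set.indicator_nonneg (fun x _ => h0 i x) x

variable {d : ℕ}

theorem continuous_gaussPDF (m : EuclideanSpace ℝ (Fin d)) (S : Matrix (Fin d) (Fin d) ℝ) :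
    Continuous (gaussPDF m S) := by
  unfold gaussPDF Matrix.mulVec dotProduct
  fun_prop

theorem measurable_gaussPDF (m : EuclideanSpace ℝ (Fin d)) (S : Matrix (Fin d) (Fin d) ℝ) :
    Measurable (gaussPDF m S) := (continuous_gaussPDF m S).measurable

theorem gaussPDF_pos (m : EuclideanSpace ℝ (Fin d)) {S : Matrix (Fin d) (Fin d) ℝ}
    (hS : S.PosDef) (x : EuclideanSpace ℝ (Fin d)) : 0 < gaussPDF m S x := by
  have := hS.det_pos
  have := Real.pi_pos
  unfold gaussPDF
  positivity

theorem gaussPDF_zero_one (x : EuclideanSpace ℝ (Fin d)) :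
    gaussPDF 0 1 x = ∏ i, gaussianPDFReal 0 1 (x i) := by
  simp only [gaussPDF, gaussianPDFReal, Finset.prod_mul_distrib, ← Real.exp_sum]
  congr 1
  · have h : √((2 * Real.pi) ^ d) = √(2 * Real.pi) ^ d := by
      rw [Real.sqrt_eq_iff_mul_self_eq (by positivity) (by positivity), ← mul_pow,
        Real.mul_self_sqrt Real.two_pi_pos.le]
    rw [Matrix.det_one, mul_one, h]
    simp [mul_pow, mul_comm]
  · simp [dotProduct, Finset.sum_div, neg_div, sq, Finset.sum_neg_distrib]

theorem stdGaussian_eq_withDensity :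
    stdGaussian (EuclideanSpace ℝ (Fin d)) =
      volume.withDensity fun x => ENNReal.ofReal (gaussPDF 0 1 x) := by
  have hmp := PiLp.volume_preserving_toLp (Fin d)
  rw [← map_pi_eq_stdGaussian]
  have h1 : gaussianReal 0 1 =
      volume.withDensity fun x => ENNReal.ofReal (gaussianPDFReal 0 1 x) := by
    rw [gaussianReal_of_var_ne_zero _ one_ne_zero]; rfl
  rw [h1, pi_withDensity_ofReal _
    (fun _ => gaussianPDFReal_nonneg 0 1) (fun _ => integrable_gaussianPDFReal 0 1), ← volume_pi]
  ext s hs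
  rw [Measure.map_apply hmp.measurable hs, withDensity_apply _ (hmp.measurable hs),
    withDensity_apply _ hs, ← hmp.setLIntegral_comp_preimage hs
      (measurable_gaussPDF 0 1).ennreal_ofReal]
  simp_rw [gaussPDF_zero_one]

open scoped MatrixOrder in
theorem isUnit_det_sqrt {Sp : Matrix (Fin d) (Fin d) ℝ} (hp : Sp.PosDef) :
    IsUnit (CFC.sqrt Sp).det := by
  have hdet := hp.det_pos
  rw [isUnit_iff_ne_zero]
  intro h
  rw [← CFC.sqrt_mul_sqrt_self Sp hp.posSemidef.nonneg, Matrix.det_mul, h] at hdet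
  simp at hdet

open scoped MatrixOrder in
theorem inv_sqrt_mul_inv_sqrt {Sp : Matrix (Fin d) (Fin d) ℝ} (hp : Sp.PosDef) :
    (CFC.sqrt Sp)⁻¹ * (CFC.sqrt Sp)⁻¹ = Sp⁻¹ := by
  rw [← Matrix.mul_inv_rev, CFC.sqrt_mul_sqrt_self Sp hp.posSemidef.nonneg]

open scoped MatrixOrder in
-- Change of variables `x ↦ m + √S x` from the standard Gaussian; `√(det S)` is the Jacobian and `√S
-- S⁻¹ √S = 1` reduces the quadratic form.
theorem gaussPDF_add_sqrt (m x : EuclideanSpace ℝ (Fin d)) {S : Matrix (Fin d) (Fin d) ℝ}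
    (hS : S.PosDef) :
    gaussPDF 0 1 x = √S.det *
      gaussPDF m S (m + Matrix.toEuclideanCLM (𝕜 := ℝ) (CFC.sqrt S) x) := by
  have hdet := hS.det_pos
  have hA : (CFC.sqrt S).IsHermitian := (CFC.sqrt_nonneg S).isSelfAdjoint
  have hAdet := isUnit_det_sqrt hS
  have hAt : (CFC.sqrt S)ᵀ = CFC.sqrt S := by simpa using hA.eq
  have hinv : CFC.sqrt S * S⁻¹ * CFC.sqrt S = 1 := by
    rw [← inv_sqrt_mul_inv_sqrt hS, ← mul_assoc, Matrix.mul_nonsing_inv _ hAdet, one_mul,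
      Matrix.nonsing_inv_mul _ hAdet]
  have hq : ((CFC.sqrt S) *ᵥ x.ofLp) ⬝ᵥ S⁻¹ *ᵥ ((CFC.sqrt S) *ᵥ x.ofLp) = x.ofLp ⬝ᵥ x.ofLp := by
    rw [Matrix.mulVec_mulVec, ← Matrix.vecMul_transpose, hAt, ← Matrix.dotProduct_mulVec,
      Matrix.mulVec_mulVec, ← mul_assoc, hinv, Matrix.one_mulVec]
  simp only [gaussPDF, add_sub_cancel_left, sub_zero, Matrix.ofLp_toEuclideanCLM, hq, inv_one,
    Matrix.one_mulVec, Matrix.det_one, mul_one]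
  rw [Real.sqrt_mul (by positivity), mul_inv]
  have : √S.det ≠ 0 := (Real.sqrt_pos.2 hdet).ne'
  field_simp

open scoped MatrixOrder in
theorem multivariateGaussian_eq_withDensity (m : EuclideanSpace ℝ (Fin d))
    {S : Matrix (Fin d) (Fin d) ℝ} (hS : S.PosDef) :
    multivariateGaussian m S = volume.withDensity fun x => ENNReal.ofReal (gaussPDF m S x) := by
  have hdet := hS.det_pos
  set T : EuclideanSpace ℝ (Fin d) →ₗ[ℝ] EuclideanSpace ℝ (Fin d) :=
    (Matrix.toEuclideanCLM (n := Fin d) (𝕜 := ℝ) (CFC.sqrt S)).toLinearMap with hT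
  have hTdet : LinearMap.det T = √S.det := by
    rw [hT, Matrix.coe_toEuclideanCLM_eq_toEuclideanLin, Matrix.toEuclideanLin,
      Matrix.toLpLin_eq_toLin,
      LinearMap.det_toLin, hS.posSemidef.det_sqrt, RCLike.sqrt_of_nonneg hdet.le]
    rfl
  have hs0 : 0 < √S.det := Real.sqrt_pos.2 hdet
  have hTm : Measurable T := (Matrix.toEuclideanCLM (𝕜 := ℝ) (CFC.sqrt S)).continuous.measurable
  have hmap : Measure.map T volume = ENNReal.ofReal (√S.det)⁻¹ • volume := by
    rw [Measure.map_linearMap_addHaar_eq_smul_addHaar _ (by rw [hTdet]; exact hs0.ne'), hTdet,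
      abs_of_pos (inv_pos.2 hs0)]
  have hm : Measurable fun x => m + T x := by fun_prop
  have hg := (measurable_gaussPDF m S).ennreal_ofReal
  rw [multivariateGaussian, stdGaussian_eq_withDensity]
  change Measure.map (fun x => m + T x) _ = _
  ext s hs
  rw [Measure.map_apply hm hs, withDensity_apply _ (hm hs), withDensity_apply _ hs,
    ← lintegral_indicator (hm hs), ← lintegral_indicator hs]
  have h1 : ∀ x, ((fun x => m + T x) ⁻¹' s).indicator
      (fun x => ENNReal.ofReal (gaussPDF 0 1 x)) x = ENNReal.ofReal √S.det *
        (s.indicator fun x => ENNReal.ofReal (gaussPDF m S x)) (m + T x) := by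
    intro x
    by_cases hx : m + T x ∈ s
    · rw [Set.indicator_of_mem (by exact hx), Set.indicator_of_mem hx,
        ← ENNReal.ofReal_mul hs0.le, gaussPDF_add_sqrt m x hS]
      rfl
    · rw [Set.indicator_of_notMem (by exact hx), Set.indicator_of_notMem hx, mul_zero]
  have hgi := hg.indicator hs
  set G := s.indicator fun x => ENNReal.ofReal (gaussPDF m S x) with hG
  have h2 : ∫⁻ x, G (m + T x) = ∫⁻ y, G (m + y) ∂(Measure.map T volume) :=
    (lintegral_map (f := fun y => G (m + y)) (hgi.comp (measurable_const_add m)) hTm).symm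
  have h3 : ∫⁻ x, ENNReal.ofReal √S.det * G (m + T x) =
      ENNReal.ofReal √S.det * ∫⁻ x, G (m + T x) := lintegral_const_mul _ (hgi.comp hm)
  rw [lintegral_congr h1, h3, h2, hmap, lintegral_smul_measure, smul_eq_mul, ← mul_assoc,
    ← ENNReal.ofReal_mul hs0.le, mul_inv_cancel₀ hs0.ne', ENNReal.ofReal_one, one_mul,
    lintegral_add_left_eq_self]

theorem lintegral_gaussPDF (m : EuclideanSpace ℝ (Fin d)) {S : Matrix (Fin d) (Fin d) ℝ}
    (hS : S.PosDef) : ∫⁻ x, ENNReal.ofReal (gaussPDF m S x) = 1 := by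
  have h := measure_univ (μ := multivariateGaussian m S)
  rwa [multivariateGaussian_eq_withDensity m hS, withDensity_apply _ MeasurableSet.univ,
    Measure.restrict_univ] at h

theorem integrable_gaussPDF (m : EuclideanSpace ℝ (Fin d)) {S : Matrix (Fin d) (Fin d) ℝ}
    (hS : S.PosDef) : Integrable (gaussPDF m S) := by
  refine ⟨(measurable_gaussPDF m S).aestronglyMeasurable, ?_⟩
  rw [hasFiniteIntegral_iff_ofReal (Eventually.of_forall fun x => (gaussPDF_pos m hS x).le)]
  rw [lintegral_gaussPDF m hS]
  exact ENNReal.one_lt_top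

variable {n : ℕ}

theorem measurable_samplePDF (m : EuclideanSpace ℝ (Fin d)) (S : Matrix (Fin d) (Fin d) ℝ) :
    Measurable (samplePDF (n := n) m S) :=
  Finset.measurable_prod _ fun i _ => (measurable_gaussPDF m S).comp (measurable_pi_apply i)

theorem samplePDF_pos (m : EuclideanSpace ℝ (Fin d)) {S : Matrix (Fin d) (Fin d) ℝ}
    (hS : S.PosDef) (u : Fin n → EuclideanSpace ℝ (Fin d)) : 0 < samplePDF m S u :=
  Finset.prod_pos fun _ _ => gaussPDF_pos m hS _

instance (m : EuclideanSpace ℝ (Fin d)) (S : Matrix (Fin d) (Fin d) ℝ) :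
    IsProbabilityMeasure (gaussSample n m S) := by
  unfold gaussSample; infer_instance

theorem gaussSample_eq_withDensity (m : EuclideanSpace ℝ (Fin d))
    {S : Matrix (Fin d) (Fin d) ℝ} (hS : S.PosDef) :
    gaussSample n m S = volume.withDensity fun u => ENNReal.ofReal (samplePDF m S u) := by
  unfold gaussSample samplePDF
  rw [multivariateGaussian_eq_withDensity m hS, pi_withDensity_ofReal _
    (fun _ x => (gaussPDF_pos m hS x).le)
    (fun _ => integrable_gaussPDF m hS), volume_pi]

end Density

/-! ### Second moments and integrability of log-densities -/

section Moments

variable {d : ℕ}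

theorem integral_quadForm_multivariateGaussian (m : EuclideanSpace ℝ (Fin d))
    {S : Matrix (Fin d) (Fin d) ℝ} (hS : S.PosSemidef) (A : Matrix (Fin d) (Fin d) ℝ) :
    Integrable (fun x : EuclideanSpace ℝ (Fin d) => (x - m).ofLp ⬝ᵥ A *ᵥ (x - m).ofLp)
        (multivariateGaussian m S) ∧
      ∫ x, (x - m).ofLp ⬝ᵥ A *ᵥ (x - m).ofLp ∂multivariateGaussian m S = (S * A).trace := by
  have h2 : ∀ i, MemLp (fun x : EuclideanSpace ℝ (Fin d) => x i) 2 (multivariateGaussian m S) :=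
    fun i => (EuclideanSpace.proj (𝕜 := ℝ) i).comp_memLp' IsGaussian.memLp_two_id
  have hmean : ∀ i, ∫ x, x i ∂multivariateGaussian m S = m i := by
    intro i
    have := (EuclideanSpace.proj (𝕜 := ℝ) i).integral_comp_comm
      (IsGaussian.integrable_id (μ := multivariateGaussian m S))
    simpa using this
  have hc : ∀ i, MemLp (fun x : EuclideanSpace ℝ (Fin d) => x i - m i) 2
      (multivariateGaussian m S) := fun i => (h2 i).sub (memLp_const _)
  have hint : ∀ i j, Integrable (fun x : EuclideanSpace ℝ (Fin d) =>
      (x i - m i) * (x j - m j)) (multivariateGaussian m S) :=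
    fun i j => (hc i).integrable_mul (hc j)
  have hcov : ∀ i j, ∫ x, (x i - m i) * (x j - m j) ∂multivariateGaussian m S = S i j := by
    intro i j
    rw [← covariance_eval_multivariateGaussian (μ := m) hS i j, covariance, hmean, hmean]
  have hexp : ∀ x : EuclideanSpace ℝ (Fin d), (x - m).ofLp ⬝ᵥ A *ᵥ (x - m).ofLp =
      ∑ i, ∑ j, A i j * ((x i - m i) * (x j - m j)) := by
    intro x
    simp only [dotProduct, Matrix.mulVec, Finset.mul_sum, PiLp.sub_apply]
    exact Finset.sum_congr rfl fun i _ => Finset.sum_congr rfl fun j _ => by ring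
  simp_rw [hexp]
  refine ⟨integrable_finsetSum _ fun i _ => integrable_finsetSum _ fun j _ =>
    (hint i j).const_mul _, ?_⟩
  have e1 : ∫ x : EuclideanSpace ℝ (Fin d), ∑ i, ∑ j, A i j * ((x i - m i) * (x j - m j))
      ∂multivariateGaussian m S = ∑ i, ∑ j, ∫ x : EuclideanSpace ℝ (Fin d),
        A i j * ((x i - m i) * (x j - m j)) ∂multivariateGaussian m S := by
    refine (integral_finsetSum _ fun i _ => integrable_finsetSum _ fun j _ =>
      (hint i j).const_mul _).trans ?_
    exact Finset.sum_congr rfl fun i _ => integral_finsetSum _ fun j _ => (hint i j).const_mul _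
  refine e1.trans ?_
  simp_rw [integral_const_mul, hcov]
  rw [Matrix.trace_mul_comm, Matrix.trace]
  simp only [Matrix.diag, Matrix.mul_apply]
  refine Finset.sum_congr rfl fun i _ => Finset.sum_congr rfl fun j _ => ?_
  rw [← hS.isHermitian.apply i j]; simp

theorem log_gaussPDF (m : EuclideanSpace ℝ (Fin d)) {S : Matrix (Fin d) (Fin d) ℝ}
    (hS : S.PosDef) (x : EuclideanSpace ℝ (Fin d)) :
    Real.log (gaussPDF m S x) = -((d : ℝ) * Real.log (2 * Real.pi) + Real.log S.det) / 2
      - ((x - m).ofLp ⬝ᵥ S⁻¹ *ᵥ (x - m).ofLp) / 2 := by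
  have hdet := hS.det_pos
  have hpi := Real.two_pi_pos
  rw [gaussPDF, Real.log_mul (by positivity) (Real.exp_pos _).ne', Real.log_exp, Real.log_inv,
    Real.log_sqrt (by positivity), Real.log_mul (by positivity) hdet.ne', Real.log_pow]
  ring

theorem gaussPDF_le (m : EuclideanSpace ℝ (Fin d)) {S : Matrix (Fin d) (Fin d) ℝ}
    (hS : S.PosDef) (x : EuclideanSpace ℝ (Fin d)) :
    gaussPDF m S x ≤ (√((2 * Real.pi) ^ d * S.det))⁻¹ := by
  have h : 0 ≤ (x - m).ofLp ⬝ᵥ S⁻¹ *ᵥ (x - m).ofLp := by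
    simpa using hS.inv.posSemidef.dotProduct_mulVec_nonneg (x - m).ofLp
  refine mul_le_of_le_one_right (by positivity) (Real.exp_le_one_iff.2 (by linarith))

theorem gaussPDF_self (m : EuclideanSpace ℝ (Fin d)) (S : Matrix (Fin d) (Fin d) ℝ) :
    gaussPDF m S m = (√((2 * Real.pi) ^ d * S.det))⁻¹ := by
  simp [gaussPDF]

theorem abs_quadForm_le (A : Matrix (Fin d) (Fin d) ℝ) (x : EuclideanSpace ℝ (Fin d)) :
    |x.ofLp ⬝ᵥ A *ᵥ x.ofLp| ≤ ‖Matrix.toEuclideanCLM (𝕜 := ℝ) A‖ * ‖x‖ ^ 2 := by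
  have h := abs_real_inner_le_norm x (Matrix.toEuclideanCLM (𝕜 := ℝ) A x)
  rw [Matrix.inner_toEuclideanCLM] at h
  refine h.trans ?_
  have := (Matrix.toEuclideanCLM (𝕜 := ℝ) A).le_opNorm x
  nlinarith [norm_nonneg x]

/-- The constants do not depend on `m`, so the bound can be integrated over `m` when the location is
mixed. -/
theorem abs_log_gaussPDF_le {S : Matrix (Fin d) (Fin d) ℝ} (hS : S.PosDef) :
    ∃ a b : ℝ, 0 ≤ a ∧ 0 ≤ b ∧ ∀ m x : EuclideanSpace ℝ (Fin d),
      |Real.log (gaussPDF m S x)| ≤ a + b * (‖x‖ ^ 2 + ‖m‖ ^ 2) := by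
  refine ⟨|-((d : ℝ) * Real.log (2 * Real.pi) + Real.log S.det) / 2|,
    ‖Matrix.toEuclideanCLM (n := Fin d) (𝕜 := ℝ) S⁻¹‖, abs_nonneg _, norm_nonneg _,
    fun m x => ?_⟩
  rw [log_gaussPDF m hS]
  refine (abs_sub _ _).trans ?_
  gcongr
  rw [abs_div, abs_two]
  have h1 := abs_quadForm_le S⁻¹ (x - m)
  have h2 : ‖x - m‖ ^ 2 ≤ 2 * (‖x‖ ^ 2 + ‖m‖ ^ 2) := by
    have := norm_sub_le x m
    nlinarith [norm_nonneg (x - m), sq_nonneg (‖x‖ - ‖m‖)]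
  have h3 := mul_le_mul_of_nonneg_left h2
    (norm_nonneg (Matrix.toEuclideanCLM (n := Fin d) (𝕜 := ℝ) S⁻¹))
  linarith

theorem integrable_norm_sq_multivariateGaussian (m : EuclideanSpace ℝ (Fin d))
    (S : Matrix (Fin d) (Fin d) ℝ) :
    Integrable (fun x => ‖x‖ ^ 2) (multivariateGaussian m S) :=
  (memLp_two_iff_integrable_sq_norm (by fun_prop)).1
    (IsGaussian.memLp_two_id (μ := multivariateGaussian m S))

theorem integrable_log_gaussPDF (μ m : EuclideanSpace ℝ (Fin d))
    {S : Matrix (Fin d) (Fin d) ℝ} (hS : S.PosDef) (T : Matrix (Fin d) (Fin d) ℝ) :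
    Integrable (fun x => Real.log (gaussPDF μ S x)) (multivariateGaussian m T) := by
  obtain ⟨a, b, -, -, h⟩ := abs_log_gaussPDF_le hS
  refine Integrable.mono' (g := fun x => a + b * (‖x‖ ^ 2 + ‖μ‖ ^ 2)) ?_ ?_
    (Eventually.of_forall fun x => h μ x)
  · exact (integrable_const _).add
      (((integrable_norm_sq_multivariateGaussian m T).add (integrable_const _)).const_mul _)
  · exact ((measurable_gaussPDF μ S).log).aestronglyMeasurable

theorem integrable_log_samplePDF {n : ℕ} (μ m : EuclideanSpace ℝ (Fin d))
    {S : Matrix (Fin d) (Fin d) ℝ} (hS : S.PosDef) (T : Matrix (Fin d) (Fin d) ℝ) :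
    Integrable (fun u => Real.log (samplePDF μ S u)) (gaussSample n m T) := by
  have : ∀ u : Fin n → EuclideanSpace ℝ (Fin d),
      Real.log (samplePDF μ S u) = ∑ i, Real.log (gaussPDF μ S (u i)) :=
    fun u => Real.log_prod fun i _ => (gaussPDF_pos μ hS (u i)).ne'
  simp_rw [this]
  exact integrable_finsetSum _ fun i _ =>
    integrable_comp_eval (μ := fun _ : Fin n => multivariateGaussian m T) (i := i)
      (integrable_log_gaussPDF μ m hS T)

end Moments

/-! ### Law and sufficiency of the sample mean -/

section SampleMean

variable {d n : ℕ}

/-- The sample mean of `n` outcomes. -/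
noncomputable def sampleMean (u : Fin n → EuclideanSpace ℝ (Fin d)) : EuclideanSpace ℝ (Fin d) :=
  (n : ℝ)⁻¹ • ∑ i, u i

theorem measurable_sampleMean : Measurable (sampleMean (d := d) (n := n)) := by
  unfold sampleMean
  fun_prop

/-- By independence, the characteristic function of the mean at `t` is the `n`-th power of that of
one outcome at `t / n`. -/
theorem map_sampleMean (hn : 1 ≤ n) (m : EuclideanSpace ℝ (Fin d))
    {S : Matrix (Fin d) (Fin d) ℝ} (hS : S.PosSemidef) :
    (gaussSample n m S).map sampleMean = multivariateGaussian m ((n : ℝ)⁻¹ • S) := by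
  have hn0 : (n : ℂ) ≠ 0 := by exact_mod_cast (by omega : n ≠ 0)
  have := Measure.isProbabilityMeasure_map (μ := gaussSample n m S)
    (measurable_sampleMean (d := d) (n := n)).aemeasurable
  refine Measure.ext_of_charFun ?_
  ext t
  rw [charFun_multivariateGaussian (hS.smul (by positivity)), charFun_apply,
    integral_map measurable_sampleMean.aemeasurable (by fun_prop)]
  have h : ∀ u : Fin n → EuclideanSpace ℝ (Fin d),
      Complex.exp (((inner ℝ (sampleMean u) t : ℝ) : ℂ) * Complex.I) =
        ∏ i, Complex.exp (((inner ℝ (u i) ((n : ℝ)⁻¹ • t) : ℝ) : ℂ) * Complex.I) := by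
    intro u
    rw [← Complex.exp_sum, ← Finset.sum_mul, ← Complex.ofReal_sum, ← sum_inner, sampleMean,
      real_inner_smul_left, real_inner_smul_right]
  simp_rw [h]
  rw [gaussSample, integral_fintype_prod_eq_pow (fun x : EuclideanSpace ℝ (Fin d) =>
    Complex.exp (((inner ℝ x ((n : ℝ)⁻¹ • t) : ℝ) : ℂ) * Complex.I)), ← charFun_apply,
    charFun_multivariateGaussian hS, ← Complex.exp_nat_mul, Fintype.card_fin]
  congr 1
  simp only [real_inner_smul_left, WithLp.ofLp_smul, Matrix.mulVec_smul, Matrix.smul_mulVec,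
    smul_dotProduct, dotProduct_smul, smul_eq_mul]
  push_cast
  field_simp

/-- The cross terms vanish because deviations from the mean sum to zero. All dependence on `μ` is
confined to the last term. -/
theorem sum_quadForm_sub (hn : 1 ≤ n) (A : Matrix (Fin d) (Fin d) ℝ)
    (μ : EuclideanSpace ℝ (Fin d)) (u : Fin n → EuclideanSpace ℝ (Fin d)) :
    ∑ i, (u i - μ).ofLp ⬝ᵥ A *ᵥ (u i - μ).ofLp =
      ∑ i, (u i - sampleMean u).ofLp ⬝ᵥ A *ᵥ (u i - sampleMean u).ofLp +
        n * ((sampleMean u - μ).ofLp ⬝ᵥ A *ᵥ (sampleMean u - μ).ofLp) := by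
  have hn0 : (n : ℝ) ≠ 0 := by exact_mod_cast (by omega : n ≠ 0)
  set y := (sampleMean u - μ).ofLp with hy
  set x := fun i => (u i - sampleMean u).ofLp with hx
  have hxy : ∀ i, (u i - μ).ofLp = x i + y := fun i => by simp [hx, hy]
  have h0 : ∑ i, x i = 0 := by
    have : ∑ i, (u i - sampleMean u) = 0 := by
      rw [Finset.sum_sub_distrib, Finset.sum_const, Finset.card_univ, Fintype.card_fin,
        ← Nat.cast_smul_eq_nsmul ℝ, sampleMean, smul_inv_smul₀ hn0, sub_self]
    simpa [hx] using congrArg WithLp.ofLp this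
  simp only [hxy, Matrix.mulVec_add, add_dotProduct, dotProduct_add, Finset.sum_add_distrib]
  have h1 : ∑ i, x i ⬝ᵥ A *ᵥ y = 0 := by rw [← sum_dotProduct, h0, zero_dotProduct]
  have h2 : ∑ i, y ⬝ᵥ A *ᵥ x i = 0 := by
    rw [← dotProduct_sum, ← Matrix.mulVec_sum, h0, Matrix.mulVec_zero, dotProduct_zero]
  rw [h1, h2, Finset.sum_const, Finset.card_univ, Fintype.card_fin, nsmul_eq_mul]
  ring

theorem inv_smul_inv_natCast (hn : 1 ≤ n) {S : Matrix (Fin d) (Fin d) ℝ} (hS : S.PosDef) :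
    ((n : ℝ)⁻¹ • S)⁻¹ = (n : ℝ) • S⁻¹ := by
  have hn0 : (n : ℝ) ≠ 0 := by exact_mod_cast (by omega : n ≠ 0)
  refine Matrix.inv_eq_right_inv ?_
  rw [Matrix.smul_mul, Matrix.mul_smul, inv_smul_smul₀ hn0,
    Matrix.mul_nonsing_inv _ hS.det_pos.ne'.isUnit]

/-- The sample mean is a sufficient statistic for the Gaussian location family. -/
theorem exists_samplePDF_eq_mul (hn : 1 ≤ n) {S : Matrix (Fin d) (Fin d) ℝ} (hS : S.PosDef) :
    ∃ R : (Fin n → EuclideanSpace ℝ (Fin d)) → ℝ, Measurable R ∧ (∀ u, 0 < R u) ∧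
      ∀ μ u, samplePDF μ S u = gaussPDF μ ((n : ℝ)⁻¹ • S) (sampleMean u) * R u := by
  have hn0 : (0 : ℝ) < n := by exact_mod_cast hn
  have hS' : ((n : ℝ)⁻¹ • S).PosDef := hS.smul (by positivity)
  -- The ratio of the sample density to the density of the mean is free of `μ`, so its value at `μ =
  -- 0` serves as `R`.
  have key : ∀ μ (u : Fin n → EuclideanSpace ℝ (Fin d)), Real.log (samplePDF μ S u) - Real.log
      (gaussPDF μ ((n : ℝ)⁻¹ • S) (sampleMean u)) = Real.log (samplePDF 0 S u) - Real.log
      (gaussPDF 0 ((n : ℝ)⁻¹ • S) (sampleMean u)) := by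
    intro μ u
    have h : ∀ μ, Real.log (samplePDF μ S u) = ∑ i, Real.log (gaussPDF μ S (u i)) :=
      fun μ => Real.log_prod fun i _ => (gaussPDF_pos μ hS (u i)).ne'
    simp only [h, log_gaussPDF _ hS, log_gaussPDF _ hS', Finset.sum_sub_distrib,
      ← Finset.sum_div, sum_quadForm_sub hn S⁻¹ μ u, sum_quadForm_sub hn S⁻¹ 0 u,
      inv_smul_inv_natCast hn hS,
      Matrix.smul_mulVec, dotProduct_smul, smul_eq_mul]
    ring
  have hpos : ∀ u : Fin n → EuclideanSpace ℝ (Fin d),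
      0 < samplePDF 0 S u / gaussPDF 0 ((n : ℝ)⁻¹ • S) (sampleMean u) :=
    fun u => div_pos (samplePDF_pos 0 hS u) (gaussPDF_pos 0 hS' _)
  refine ⟨_, (measurable_samplePDF 0 S).div ((measurable_gaussPDF 0 _).comp measurable_sampleMean),
    hpos, fun μ u => ?_⟩
  have h1 := samplePDF_pos μ hS u
  have h2 := gaussPDF_pos μ hS' (sampleMean u)
  refine Real.log_injOn_pos h1 (mul_pos h2 (hpos u)) ?_
  have := key μ u
  simp only [Function.comp_apply, Pi.div_apply]
  rw [Real.log_mul h2.ne' (hpos u).ne', Real.log_div (samplePDF_pos 0 hS u).ne'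
    (gaussPDF_pos 0 hS' _).ne']
  linarith

theorem iSup_samplePDF (hn : 1 ≤ n) {S : Matrix (Fin d) (Fin d) ℝ} (hS : S.PosDef)
    (u : Fin n → EuclideanSpace ℝ (Fin d)) :
    ⨆ μ, samplePDF μ S u = samplePDF (sampleMean u) S u := by
  have hn0 : (0 : ℝ) < n := by exact_mod_cast hn
  have hS' : ((n : ℝ)⁻¹ • S).PosDef := hS.smul (by positivity)
  obtain ⟨R, -, hR, h⟩ := exists_samplePDF_eq_mul (d := d) hn hS
  have hle : ∀ μ, samplePDF μ S u ≤ samplePDF (sampleMean u) S u := by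
    intro μ
    rw [h, h, gaussPDF_self]
    exact mul_le_mul_of_nonneg_right (gaussPDF_le μ hS' _) (hR u).le
  exact le_antisymm (ciSup_le hle) (le_ciSup ⟨_, Set.forall_mem_range.2 hle⟩ _)

end SampleMean

/-! ### Gaussian mixtures and expected likelihood ratios -/

section Convolution

variable {d : ℕ}

theorem conv_multivariateGaussian (m m' : EuclideanSpace ℝ (Fin d))
    {S T : Matrix (Fin d) (Fin d) ℝ} (hS : S.PosSemidef) (hT : T.PosSemidef) :
    multivariateGaussian m S ∗ multivariateGaussian m' T =
      multivariateGaussian (m + m') (S + T) := by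
  refine Measure.ext_of_charFun ?_
  ext t
  rw [charFun_conv, charFun_multivariateGaussian hS, charFun_multivariateGaussian hT,
    charFun_multivariateGaussian (hS.add hT), ← Complex.exp_add]
  congr 1
  simp only [inner_add_right, Matrix.add_mulVec, dotProduct_add]
  push_cast
  ring

theorem continuous_gaussPDF_uncurry (S : Matrix (Fin d) (Fin d) ℝ) :
    Continuous fun p : EuclideanSpace ℝ (Fin d) × EuclideanSpace ℝ (Fin d) =>
      gaussPDF p.1 S p.2 := by
  unfold gaussPDF Matrix.mulVec dotProduct
  fun_prop

/-- A Gaussian mixture of a Gaussian location family is Gaussian. -/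
theorem lintegral_gaussPDF_multivariateGaussian (m : EuclideanSpace ℝ (Fin d))
    {S T : Matrix (Fin d) (Fin d) ℝ} (hS : S.PosDef) (hT : T.PosSemidef) :
    ∀ᵐ x, ∫⁻ z, ENNReal.ofReal (gaussPDF z S x) ∂multivariateGaussian m T =
      ENNReal.ofReal (gaussPDF m (T + S) x) := by
  have hTS : (T + S).PosDef := hS.posSemidef_add hT
  have hmeas : Measurable fun p : EuclideanSpace ℝ (Fin d) × EuclideanSpace ℝ (Fin d) =>
      ENNReal.ofReal (gaussPDF p.1 S p.2) :=
    (continuous_gaussPDF_uncurry S).measurable.ennreal_ofReal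
  have hshift : ∀ z x : EuclideanSpace ℝ (Fin d), gaussPDF z S (z + x) = gaussPDF 0 S x := by
    intro z x; simp [gaussPDF]
  -- Both sides are densities of `N(m, T) ∗ N(0, S)`; comparing measures identifies them almost
  -- everywhere, which is all that is needed.
  have h : (volume.withDensity fun x => ∫⁻ z, ENNReal.ofReal (gaussPDF z S x)
      ∂multivariateGaussian m T) = multivariateGaussian m (T + S) := by
    have hc := conv_multivariateGaussian m 0 hT hS.posSemidef
    rw [add_zero] at hc
    rw [← hc]
    refine Measure.ext_of_lintegral _ fun f hf => ?_
    rw [Measure.lintegral_conv hf, lintegral_withDensity_eq_lintegral_mul _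
      hmeas.lintegral_prod_left' hf]
    simp only [Pi.mul_apply]
    have h1 : ∀ z, ∫⁻ y, f (z + y) ∂multivariateGaussian 0 S =
        ∫⁻ x, ENNReal.ofReal (gaussPDF z S x) * f x := by
      intro z
      rw [multivariateGaussian_eq_withDensity 0 hS, lintegral_withDensity_eq_lintegral_mul _
        (measurable_gaussPDF 0 S).ennreal_ofReal (g := fun y => f (z + y))
        (hf.comp (measurable_const_add z)),
        ← lintegral_add_left_eq_self (fun x => ENNReal.ofReal (gaussPDF z S x) * f x) z]
      simp [hshift]
    simp_rw [h1]
    rw [lintegral_lintegral_swap (by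
      exact (hmeas.mul (hf.comp measurable_snd)).aemeasurable)]
    refine lintegral_congr fun x => ?_
    exact (lintegral_mul_const _ (hmeas.comp (measurable_id.prodMk measurable_const))).symm
  rw [multivariateGaussian_eq_withDensity m hTS] at h
  exact (withDensity_eq_iff_of_sigmaFinite hmeas.lintegral_prod_left'.aemeasurable
    (measurable_gaussPDF m (T + S)).ennreal_ofReal.aemeasurable).1 h

/-- If `T ≤ S`, then the likelihood ratios of the location family with covariance `S` have
expectation at most one under `N(m, T)`. -/
theorem lintegral_gaussPDF_div_le_one (μ m : EuclideanSpace ℝ (Fin d))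
    {S T : Matrix (Fin d) (Fin d) ℝ} (hS : S.PosDef) (hT : T.PosSemidef)
    (hST : (S - T).PosSemidef) :
    ∫⁻ x, ENNReal.ofReal (gaussPDF μ S x / gaussPDF m S x) ∂multivariateGaussian m T ≤ 1 := by
  -- The ratio is `exp (⟨w, x - m⟩ - c / 2)` with `c = wᵀ S w`. Under `N(m, T)` the exponent's
  -- linear part has variance `wᵀ T w`, so the expectation is `exp ((wᵀ T w - wᵀ S w) / 2)`.
  set w : EuclideanSpace ℝ (Fin d) := WithLp.toLp 2 (S⁻¹ *ᵥ (μ - m).ofLp) with hw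
  set c := w.ofLp ⬝ᵥ S *ᵥ w.ofLp with hc
  have hSw : S *ᵥ w.ofLp = (μ - m).ofLp := by
    rw [hw, Matrix.mulVec_mulVec, Matrix.mul_nonsing_inv _ hS.det_pos.ne'.isUnit,
      Matrix.one_mulVec]
  have hsymm : ∀ v v' : Fin d → ℝ, v ⬝ᵥ S⁻¹ *ᵥ v' = v' ⬝ᵥ S⁻¹ *ᵥ v := by
    intro v v'
    have : (S⁻¹)ᵀ = S⁻¹ := by simpa using hS.inv.isHermitian.eq
    rw [Matrix.dotProduct_mulVec, ← Matrix.mulVec_transpose, this, dotProduct_comm]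
  have hratio : ∀ x, gaussPDF μ S x / gaussPDF m S x =
      Real.exp (-inner ℝ w m - c / 2) * Real.exp (inner ℝ w x) := by
    intro x
    refine Real.log_injOn_pos (div_pos (gaussPDF_pos _ hS x) (gaussPDF_pos _ hS x))
      (Set.mem_Ioi.2 (by positivity)) ?_
    rw [Real.log_div (gaussPDF_pos _ hS x).ne' (gaussPDF_pos _ hS x).ne', log_gaussPDF _ hS,
      log_gaussPDF _ hS, ← Real.exp_add, Real.log_exp]
    have e1 : (x - μ).ofLp = (x - m).ofLp - (μ - m).ofLp := by simp
    have e2 : inner ℝ w x - inner ℝ w m = (x - m).ofLp ⬝ᵥ S⁻¹ *ᵥ (μ - m).ofLp := by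
      rw [← inner_sub_right, EuclideanSpace.inner_eq_star_dotProduct]
      simp [hw]
    have e3 : c = (μ - m).ofLp ⬝ᵥ S⁻¹ *ᵥ (μ - m).ofLp := by
      rw [hc, hSw, dotProduct_comm]
    rw [e1, Matrix.mulVec_sub, sub_dotProduct, dotProduct_sub, dotProduct_sub,
      hsymm (μ - m).ofLp (x - m).ofLp, ← e2, ← e3]
    ring
  have hle : w.ofLp ⬝ᵥ T *ᵥ w.ofLp ≤ c := by
    have := hST.dotProduct_mulVec_nonneg w.ofLp
    rw [Matrix.sub_mulVec, dotProduct_sub] at this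
    simpa using this
  have hmap := IsGaussian.map_eq_gaussianReal (μ := multivariateGaussian m T) (innerSL ℝ w)
  have hmean : ∫ x, innerSL ℝ w x ∂multivariateGaussian m T = inner ℝ w m := by
    rw [ContinuousLinearMap.integral_comp_id_comm IsGaussian.integrable_id]; simp
  have hvar : Var[innerSL ℝ w; multivariateGaussian m T] = w.ofLp ⬝ᵥ T *ᵥ w.ofLp := by
    rw [← covarianceBilin_multivariateGaussian (μ := m) hT, covarianceBilin_self]
    · rfl
    · exact IsGaussian.memLp_two_id
  have hnn : 0 ≤ w.ofLp ⬝ᵥ T *ᵥ w.ofLp := by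
    simpa using hT.dotProduct_mulVec_nonneg w.ofLp
  rw [hmean, hvar] at hmap
  have hinn : Measurable (fun x => inner ℝ w x) := by fun_prop
  have hexp : Integrable (fun x => Real.exp (inner ℝ w x)) (multivariateGaussian m T) := by
    have h := integrable_exp_mul_gaussianReal (μ := inner ℝ w m)
      (v := (w.ofLp ⬝ᵥ T *ᵥ w.ofLp).toNNReal) 1
    rw [← hmap, integrable_map_measure (by fun_prop) (by fun_prop)] at h
    simpa [Function.comp_def] using h
  have hval : ∫ x, Real.exp (inner ℝ w x) ∂multivariateGaussian m T =
      Real.exp (inner ℝ w m + w.ofLp ⬝ᵥ T *ᵥ w.ofLp / 2) := by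
    have h := mgf_gaussianReal hmap 1
    rw [mgf] at h
    simpa [hnn] using h
  simp_rw [hratio]
  rw [← ofReal_integral_eq_lintegral_ofReal (hexp.const_mul _)
    (Eventually.of_forall fun x => by positivity), integral_const_mul, hval, ← Real.exp_add]
  rw [ENNReal.ofReal_le_one, Real.exp_le_one_iff]
  linarith

end Convolution

/-! ### Discretising a Gaussian mixture -/

section Approximation

variable {d : ℕ}

/-- Simple functions converging pointwise to the identity. -/
noncomputable def approxId (d k : ℕ) :
    SimpleFunc (EuclideanSpace ℝ (Fin d)) (EuclideanSpace ℝ (Fin d)) :=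
  SimpleFunc.approxOn id measurable_id Set.univ 0 (Set.mem_univ _) k

theorem tendsto_approxId (z : EuclideanSpace ℝ (Fin d)) :
    Tendsto (fun k => approxId d k z) atTop (𝓝 z) :=
  SimpleFunc.tendsto_approxOn measurable_id (Set.mem_univ _) (by simp)

theorem norm_approxId_le (k : ℕ) (z : EuclideanSpace ℝ (Fin d)) :
    ‖approxId d k z‖ ≤ 2 * ‖z‖ := by
  have := SimpleFunc.norm_approxOn_zero_le (f := id) measurable_id
    (Set.mem_univ (0 : EuclideanSpace ℝ (Fin d))) z k
  simp only [id] at this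
  rw [two_mul]
  exact this

/-- The finite Gaussian mixture with mixing distribution the image of `N` under `approxId`. -/
noncomputable def approxMix (N : Measure (EuclideanSpace ℝ (Fin d)))
    (S : Matrix (Fin d) (Fin d) ℝ) (k : ℕ) (x : EuclideanSpace ℝ (Fin d)) : ℝ :=
  ∫ z, gaussPDF (approxId d k z) S x ∂N

theorem continuous_gaussPDF_left (S : Matrix (Fin d) (Fin d) ℝ) (x : EuclideanSpace ℝ (Fin d)) :
    Continuous fun z => gaussPDF z S x := by
  unfold gaussPDF Matrix.mulVec dotProduct
  fun_prop

theorem approxMix_eq_sum (N : Measure (EuclideanSpace ℝ (Fin d))) [IsProbabilityMeasure N]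
    {S : Matrix (Fin d) (Fin d) ℝ} (hS : S.PosDef) (k : ℕ) (x : EuclideanSpace ℝ (Fin d)) :
    approxMix N S k x = ∑ y ∈ (approxId d k).range,
      ((N (approxId d k ⁻¹' {y})).toNNReal : ℝ) * gaussPDF y S x := by
  have h := SimpleFunc.map_lintegral (μ := N) (fun y => ENNReal.ofReal (gaussPDF y S x))
    (approxId d k)
  rw [← SimpleFunc.lintegral_eq_lintegral] at h
  rw [approxMix, integral_eq_lintegral_of_nonneg_ae
    (Eventually.of_forall fun z => (gaussPDF_pos _ hS x).le)
    ((continuous_gaussPDF_left S x).measurable.comp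
      (approxId d k).measurable).aestronglyMeasurable]
  refine (congrArg ENNReal.toReal h).trans ?_
  rw [ENNReal.toReal_sum fun y _ => ENNReal.mul_ne_top ENNReal.ofReal_ne_top (measure_ne_top N _)]
  refine Finset.sum_congr rfl fun y _ => ?_
  rw [ENNReal.toReal_mul, ENNReal.toReal_ofReal (gaussPDF_pos _ hS x).le, mul_comm]
  rfl

theorem sum_measure_preimage_approxId (N : Measure (EuclideanSpace ℝ (Fin d)))
    [IsProbabilityMeasure N] (k : ℕ) :
    ∑ y ∈ (approxId d k).range, (N (approxId d k ⁻¹' {y})).toNNReal = 1 := by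
  have h := SimpleFunc.sum_range_measure_preimage_singleton (approxId d k) N
  rw [measure_univ] at h
  rw [← ENNReal.toNNReal_sum fun y _ => measure_ne_top N _, h, ENNReal.toNNReal_one]

/-- Supplies the dominating function, uniform in `k`. From above, a mixture is at most the peak of
the density; from below, Jensen for `exp` bounds its logarithm by the averaged log-density. -/
theorem approxMix_bounds (m : EuclideanSpace ℝ (Fin d)) {S : Matrix (Fin d) (Fin d) ℝ}
    (hS : S.PosDef) (T : Matrix (Fin d) (Fin d) ℝ) :
    ∃ a b : ℝ, ∀ k x, |Real.log (approxMix (multivariateGaussian m T) S k x)| ≤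
      a + b * ‖x‖ ^ 2 := by
  obtain ⟨a, b, ha, hb, hab⟩ := abs_log_gaussPDF_le hS
  set N := multivariateGaussian m T
  set c := (√((2 * Real.pi) ^ d * S.det))⁻¹
  set M := ∫ z, ‖z‖ ^ 2 ∂N
  have hM0 : 0 ≤ M := integral_nonneg fun z => by positivity
  have hMI : Integrable (fun z => ‖z‖ ^ 2) N := integrable_norm_sq_multivariateGaussian m T
  refine ⟨|Real.log c| + a + 4 * b * M, b, fun k x => ?_⟩
  have hI : ∀ g : EuclideanSpace ℝ (Fin d) → ℝ, Integrable (fun z => g (approxId d k z)) N :=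
    fun g => SimpleFunc.integrable_of_isFiniteMeasure ((approxId d k).map g)
  have hexp : ∀ z, Real.exp (Real.log (gaussPDF (approxId d k z) S x)) =
      gaussPDF (approxId d k z) S x := fun z => Real.exp_log (gaussPDF_pos _ hS x)
  have hJ : Real.exp (∫ z, Real.log (gaussPDF (approxId d k z) S x) ∂N) ≤
      approxMix N S k x := by
    have := convexOn_exp.map_integral_le (μ := N) Real.continuous_exp.continuousOn isClosed_univ
      (Eventually.of_forall fun z => Set.mem_univ _)
      (hI fun y => Real.log (gaussPDF y S x))
      (hI fun y => Real.exp (Real.log (gaussPDF y S x)))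
    simp only [hexp] at this
    exact this
  have hpos : 0 < approxMix N S k x := (Real.exp_pos _).trans_le hJ
  have hlow : ∫ z, Real.log (gaussPDF (approxId d k z) S x) ∂N ≤
      Real.log (approxMix N S k x) := (Real.le_log_iff_exp_le hpos).2 hJ
  have hlow2 : -(a + b * ‖x‖ ^ 2 + 4 * b * M) ≤
      ∫ z, Real.log (gaussPDF (approxId d k z) S x) ∂N := by
    have h := integral_mono (μ := N) (f := fun z => -(a + b * ‖x‖ ^ 2) + -(4 * b) * ‖z‖ ^ 2)
      ((integrable_const _).add (hMI.const_mul _)) (hI fun y => Real.log (gaussPDF y S x))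
      (fun z => by
        have h1 := neg_abs_le (Real.log (gaussPDF (approxId d k z) S x))
        have h2 := hab (approxId d k z) x
        -- Squaring `norm_approxId_le`; this is the source of the factor 4 in `4 * b * M`.
        have h3 : ‖approxId d k z‖ ^ 2 ≤ 4 * ‖z‖ ^ 2 := by
          have := norm_approxId_le k z
          nlinarith [norm_nonneg (approxId d k z), norm_nonneg z]
        have h4 := mul_le_mul_of_nonneg_left h3 hb
        dsimp only
        linarith)
    have e : ∫ z, -(a + b * ‖x‖ ^ 2) + -(4 * b) * ‖z‖ ^ 2 ∂N =
        -(a + b * ‖x‖ ^ 2) + -(4 * b) * M := by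
      rw [integral_add (integrable_const _) (hMI.const_mul _), integral_const_mul, integral_const,
        probReal_univ, one_smul]
    rw [e] at h
    linarith
  have hup : approxMix N S k x ≤ c := by
    have := integral_mono (μ := N) (hI fun y => gaussPDF y S x) (integrable_const c)
      (fun z => gaussPDF_le _ hS x)
    simpa [approxMix] using this
  have hup2 := Real.log_le_log hpos hup
  have := le_abs_self (Real.log c)
  have := abs_nonneg (Real.log c)
  have : 0 ≤ b * ‖x‖ ^ 2 := by positivity
  have : 0 ≤ 4 * b * M := by positivity
  rw [abs_le]
  constructor <;> linarith

theorem tendsto_approxMix (m : EuclideanSpace ℝ (Fin d)) {S T : Matrix (Fin d) (Fin d) ℝ}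
    (hS : S.PosDef) (hT : T.PosSemidef) :
    ∀ᵐ x, Tendsto (fun k => approxMix (multivariateGaussian m T) S k x) atTop
      (𝓝 (gaussPDF m (T + S) x)) := by
  have hTS : (T + S).PosDef := hS.posSemidef_add hT
  filter_upwards [lintegral_gaussPDF_multivariateGaussian m hS hT] with x hx
  have hlim : ∫ z, gaussPDF z S x ∂multivariateGaussian m T = gaussPDF m (T + S) x := by
    rw [integral_eq_lintegral_of_nonneg_ae (Eventually.of_forall fun z => (gaussPDF_pos z hS x).le)
      (continuous_gaussPDF_left S x).aestronglyMeasurable, hx,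
      ENNReal.toReal_ofReal (gaussPDF_pos m hTS x).le]
  rw [← hlim]
  refine tendsto_integral_of_dominated_convergence
    (fun _ => (√((2 * Real.pi) ^ d * S.det))⁻¹) (fun k => ?_) (integrable_const _) (fun k => ?_) ?_
  · exact ((continuous_gaussPDF_left S x).measurable.comp
      (approxId d k).measurable).aestronglyMeasurable
  · refine Eventually.of_forall fun z => ?_
    rw [Real.norm_of_nonneg (gaussPDF_pos _ hS x).le]
    exact gaussPDF_le _ hS x
  · exact Eventually.of_forall fun z =>
      ((continuous_gaussPDF_left S x).tendsto z).comp (tendsto_approxId z)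

theorem measurable_approxMix (N : Measure (EuclideanSpace ℝ (Fin d))) [IsProbabilityMeasure N]
    {S : Matrix (Fin d) (Fin d) ℝ} (hS : S.PosDef) (k : ℕ) : Measurable (approxMix N S k) := by
  have : approxMix N S k = fun x => ∑ y ∈ (approxId d k).range,
      ((N (approxId d k ⁻¹' {y})).toNNReal : ℝ) * gaussPDF y S x :=
    funext fun x => approxMix_eq_sum N hS k x
  rw [this]
  exact Finset.measurable_sum _ fun y _ => (measurable_gaussPDF y S).const_mul _

theorem tendsto_integral_log_approxMix (m : EuclideanSpace ℝ (Fin d))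
    {S T : Matrix (Fin d) (Fin d) ℝ} (hS : S.PosDef) (hT : T.PosSemidef) :
    Tendsto (fun k => ∫ x, Real.log (gaussPDF m (T + S) x) -
        Real.log (approxMix (multivariateGaussian m T) S k x) ∂multivariateGaussian m (T + S))
      atTop (𝓝 0) := by
  have hTS : (T + S).PosDef := hS.posSemidef_add hT
  obtain ⟨a, b, hab⟩ := approxMix_bounds m hS T
  set N := multivariateGaussian m (T + S) with hN
  have hac : N ≪ volume := by
    rw [hN, multivariateGaussian_eq_withDensity m hTS]
    exact withDensity_absolutelyContinuous _ _
  have hI := integrable_log_gaussPDF m m hTS (T + S)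
  have h0 : (0 : ℝ) = ∫ x, (0 : ℝ) ∂N := by simp
  rw [h0]
  refine tendsto_integral_of_dominated_convergence
    (fun x => |Real.log (gaussPDF m (T + S) x)| + (a + b * ‖x‖ ^ 2)) (fun k => ?_) ?_
    (fun k => ?_) ?_
  · exact ((measurable_gaussPDF m _).log.sub
      (measurable_approxMix _ hS k).log).aestronglyMeasurable
  · exact hI.abs.add ((integrable_const _).add
      ((integrable_norm_sq_multivariateGaussian m (T + S)).const_mul _))
  · refine Eventually.of_forall fun x => ?_
    exact (abs_sub _ _).trans (add_le_add_right (hab k x) _)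
  · filter_upwards [hac.ae_le (tendsto_approxMix m hS hT)] with x hx
    have h := (Real.continuousAt_log (gaussPDF_pos m hTS x).ne').tendsto.comp hx
    simpa using h.const_sub (Real.log (gaussPDF m (T + S) x))

end Approximation

/-! ### The projection and the expected log-ratio -/

section Projection

variable {d n : ℕ}

theorem integral_comp_sampleMean (hn : 1 ≤ n) (m : EuclideanSpace ℝ (Fin d))
    {S : Matrix (Fin d) (Fin d) ℝ} (hS : S.PosSemidef) {f : EuclideanSpace ℝ (Fin d) → ℝ}
    (hf : Measurable f) :
    ∫ u, f (sampleMean u) ∂gaussSample n m S =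
      ∫ x, f x ∂multivariateGaussian m ((n : ℝ)⁻¹ • S) := by
  rw [← map_sampleMean hn m hS, integral_map measurable_sampleMean.aemeasurable
    hf.aestronglyMeasurable]

theorem lintegral_comp_sampleMean (hn : 1 ≤ n) (m : EuclideanSpace ℝ (Fin d))
    {S : Matrix (Fin d) (Fin d) ℝ} (hS : S.PosSemidef) {f : EuclideanSpace ℝ (Fin d) → ℝ≥0∞}
    (hf : Measurable f) :
    ∫⁻ u, f (sampleMean u) ∂gaussSample n m S =
      ∫⁻ x, f x ∂multivariateGaussian m ((n : ℝ)⁻¹ • S) := by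
  rw [← map_sampleMean hn m hS, lintegral_map hf measurable_sampleMean]

theorem integrable_comp_sampleMean (hn : 1 ≤ n) (m : EuclideanSpace ℝ (Fin d))
    {S : Matrix (Fin d) (Fin d) ℝ} (hS : S.PosSemidef) {f : EuclideanSpace ℝ (Fin d) → ℝ}
    (hf : Measurable f) (hI : Integrable f (multivariateGaussian m ((n : ℝ)⁻¹ • S))) :
    Integrable (fun u => f (sampleMean u)) (gaussSample n m S) := by
  rw [← map_sampleMean hn m hS] at hI
  exact (integrable_map_measure hf.aestronglyMeasurable measurable_sampleMean.aemeasurable).1 hI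

theorem lintegral_gaussPDF_div_self (μ m : EuclideanSpace ℝ (Fin d))
    {S T : Matrix (Fin d) (Fin d) ℝ} (hS : S.PosDef) (hT : T.PosDef) :
    ∫⁻ x, ENNReal.ofReal (gaussPDF μ S x / gaussPDF m T x) ∂multivariateGaussian m T = 1 := by
  rw [multivariateGaussian_eq_withDensity m hT, lintegral_withDensity_eq_lintegral_mul _
    (measurable_gaussPDF m T).ennreal_ofReal
    (g := fun x => ENNReal.ofReal (gaussPDF μ S x / gaussPDF m T x))
    ((measurable_gaussPDF μ S).div (measurable_gaussPDF m T)).ennreal_ofReal,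
    ← lintegral_gaussPDF μ hS]
  refine lintegral_congr fun x => ?_
  have := gaussPDF_pos m hT x
  rw [Pi.mul_apply, ← ENNReal.ofReal_mul this.le, mul_div_cancel₀ _ this.ne']

/-- If finite mixtures of the null at the level of the sample mean approach `N(m, S₀)`, and the
likelihood ratios against `N(m, S₀)` have expectation at most one, then the projection is the
sample density whose sample mean has law `N(m, S₀)`. -/
theorem isGaussRIPr_gaussPDF_mul (hn : 1 ≤ n) (m : EuclideanSpace ℝ (Fin d))
    {Sp Sq S₀ : Matrix (Fin d) (Fin d) ℝ} (hp : Sp.PosDef) (hq : Sq.PosDef) (h0 : S₀.PosDef)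
    {R : (Fin n → EuclideanSpace ℝ (Fin d)) → ℝ} (hRm : Measurable R) (hR0 : ∀ u, 0 < R u)
    (hR : ∀ μ u, samplePDF μ Sp u = gaussPDF μ ((n : ℝ)⁻¹ • Sp) (sampleMean u) * R u)
    (hle : ∀ μ, ∫⁻ x, ENNReal.ofReal (gaussPDF μ ((n : ℝ)⁻¹ • Sp) x / gaussPDF m S₀ x)
      ∂multivariateGaussian m ((n : ℝ)⁻¹ • Sq) ≤ 1)
    (t : ℕ → Finset (EuclideanSpace ℝ (Fin d))) (w : ℕ → EuclideanSpace ℝ (Fin d) → ℝ≥0)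
    (hw : ∀ k, ∑ y ∈ t k, w k y = 1)
    (ht : Tendsto (fun k => ∫ x, Real.log (gaussPDF m S₀ x) -
        Real.log (∑ y ∈ t k, (w k y : ℝ) * gaussPDF y ((n : ℝ)⁻¹ • Sp) x)
          ∂multivariateGaussian m ((n : ℝ)⁻¹ • Sq)) atTop (𝓝 0)) :
    IsGaussRIPr n m Sp Sq (fun u => gaussPDF m S₀ (sampleMean u) * R u) ∧
      ∀ g, IsGaussRIPr n m Sp Sq g →
        g =ᵐ[gaussSample n m Sq] fun u => gaussPDF m S₀ (sampleMean u) * R u := by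
  have hn0 : (0 : ℝ) < n := by exact_mod_cast hn
  have hp' : ((n : ℝ)⁻¹ • Sp).PosDef := hp.smul (by positivity)
  have hms := measurable_sampleMean (d := d) (n := n)
  set Q := gaussSample n m Sq with hQ
  set g : (Fin n → EuclideanSpace ℝ (Fin d)) → ℝ := fun u => gaussPDF m S₀ (sampleMean u) * R u
    with hg
  have hgm : Measurable g := ((measurable_gaussPDF m S₀).comp hms).mul hRm
  have hg0 : ∀ u, 0 < g u := fun u => mul_pos (gaussPDF_pos m h0 _) (hR0 u)
  have hRl : ∀ u, Real.log (R u) = Real.log (samplePDF m Sp u) -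
      Real.log (gaussPDF m ((n : ℝ)⁻¹ • Sp) (sampleMean u)) := by
    intro u
    rw [hR, Real.log_mul (gaussPDF_pos m hp' _).ne' (hR0 u).ne']
    ring
  have hlogmean : ∀ S : Matrix (Fin d) (Fin d) ℝ, S.PosDef →
      Integrable (fun u => Real.log (gaussPDF m S (sampleMean u))) Q := fun S hS =>
    integrable_comp_sampleMean hn m hq.posSemidef (measurable_gaussPDF m S).log
      (integrable_log_gaussPDF m m hS _)
  have hgl : Integrable (fun u => Real.log (g u)) Q := by
    have h : ∀ u, Real.log (g u) = Real.log (gaussPDF m S₀ (sampleMean u)) +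
        (Real.log (samplePDF m Sp u) -
          Real.log (gaussPDF m ((n : ℝ)⁻¹ • Sp) (sampleMean u))) := fun u => by
      rw [hg, Real.log_mul (gaussPDF_pos m h0 _).ne' (hR0 u).ne', hRl]
    simp_rw [h]
    exact (hlogmean S₀ h0).add ((integrable_log_samplePDF m m hp Sq).sub (hlogmean _ hp'))
  -- `g / p_m` depends only on the sample mean, so the mass of `g` is the expectation of `N(m, S₀) /
  -- N(m, Sp/n)` under `N(m, Sp/n)`, which is one.
  have hg1 : ∫⁻ u, ENNReal.ofReal (g u) ≤ 1 := by
    have h := lintegral_comp_sampleMean hn m hp.posSemidef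
      (f := fun x => ENNReal.ofReal (gaussPDF m S₀ x / gaussPDF m ((n : ℝ)⁻¹ • Sp) x))
      ((measurable_gaussPDF m S₀).div (measurable_gaussPDF m _)).ennreal_ofReal
    rw [lintegral_gaussPDF_div_self m m h0 hp', gaussSample_eq_withDensity m hp,
      lintegral_withDensity_eq_lintegral_mul _ (measurable_samplePDF m Sp).ennreal_ofReal
        (g := fun u => ENNReal.ofReal (gaussPDF m S₀ (sampleMean u) /
          gaussPDF m ((n : ℝ)⁻¹ • Sp) (sampleMean u)))
        (((measurable_gaussPDF m S₀).div
          (measurable_gaussPDF m _)).ennreal_ofReal.comp hms)] at h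
    refine le_of_eq (Eq.trans (lintegral_congr fun u => ?_) h)
    have h1 := (gaussPDF_pos m hp' (sampleMean u)).ne'
    rw [Pi.mul_apply, ← ENNReal.ofReal_mul (samplePDF_pos m hp u).le, hR, hg, mul_right_comm,
      mul_div_cancel₀ _ h1]
  have hnull : ∀ μ, HasDominatedDensity volume Q g (gaussSample n μ Sp) (samplePDF μ Sp) := by
    intro μ
    refine ⟨measurable_samplePDF μ Sp, samplePDF_pos μ hp, gaussSample_eq_withDensity μ hp,
      measure_univ, integrable_log_samplePDF μ m hp Sq, ?_⟩
    have h := lintegral_comp_sampleMean hn m hq.posSemidef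
      (f := fun x => ENNReal.ofReal (gaussPDF μ ((n : ℝ)⁻¹ • Sp) x / gaussPDF m S₀ x))
      ((measurable_gaussPDF μ _).div (measurable_gaussPDF m _)).ennreal_ofReal
    refine le_trans (le_of_eq (Eq.trans (lintegral_congr fun u => ?_) h)) (hle μ)
    rw [hR, hg, mul_div_mul_right _ _ (hR0 u).ne']
  have hC : ∀ P ∈ convexHull ℝ≥0 (nullFamily n Sp), ∃ p, HasDominatedDensity volume Q g P p :=
    fun P hP => exists_hasDominatedDensity_of_mem_convexHull hgm hg0
      (by rintro _ ⟨μ, rfl⟩; exact ⟨_, hnull μ⟩) hP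
  have happ : ∃ P : ℕ → Measure _, ∃ p : ℕ → _ → ℝ,
      (∀ k, P k ∈ convexHull ℝ≥0 (nullFamily n Sp)) ∧
      (∀ k, HasDominatedDensity volume Q g (P k) (p k)) ∧
      Tendsto (fun k => ∫ u, Real.log (g u) - Real.log (p k u) ∂Q) atTop (𝓝 0) := by
    have hmem := fun k => convex_nnreal_sum_mem (convex_hasDominatedDensity (ν := volume) (Q := Q)
      hgm hg0) (t k) (w k) (fun y => (gaussSample n y Sp, samplePDF y Sp)) (hw k)
      (fun y _ => hnull y)
    refine ⟨fun k => ∑ y ∈ t k, w k y • gaussSample n y Sp,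
      fun k => ∑ y ∈ t k, w k y • samplePDF y Sp, fun k => ?_, fun k => ?_, ?_⟩
    · exact convex_nnreal_sum_mem (convex_convexHull _ _) _ _ _ (hw k)
        fun y _ => subset_convexHull _ _ ⟨y, rfl⟩
    · simpa [Prod.fst_sum, Prod.snd_sum] using hmem k
    · refine ht.congr fun k => ?_
      have hmix : Measurable fun x => ∑ y ∈ t k, (w k y : ℝ) * gaussPDF y ((n : ℝ)⁻¹ • Sp) x :=
        Finset.measurable_sum _ fun y _ => (measurable_gaussPDF y _).const_mul _
      rw [← integral_comp_sampleMean hn m hq.posSemidef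
        (f := fun x => Real.log (gaussPDF m S₀ x) -
          Real.log (∑ y ∈ t k, (w k y : ℝ) * gaussPDF y ((n : ℝ)⁻¹ • Sp) x))
        ((measurable_gaussPDF m S₀).log.sub hmix.log)]
      refine integral_congr_ae (Eventually.of_forall fun u => ?_)
      have hpos : 0 < ∑ y ∈ t k, (w k y : ℝ) * gaussPDF y ((n : ℝ)⁻¹ • Sp) (sampleMean u) := by
        refine lt_of_le_of_ne (Finset.sum_nonneg fun y _ =>
          mul_nonneg (w k y).coe_nonneg (gaussPDF_pos y hp' _).le) fun h => ?_
        have h2 : ∀ y ∈ t k, w k y = 0 := fun y hy => by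
          have := (Finset.sum_eq_zero_iff_of_nonneg fun y _ =>
            mul_nonneg (w k y).coe_nonneg (gaussPDF_pos y hp' _).le).1 h.symm y hy
          simpa [(gaussPDF_pos y hp' _).ne'] using this
        have := hw k
        rw [Finset.sum_eq_zero h2] at this
        exact zero_ne_one this
      have hsum : (∑ y ∈ t k, w k y • samplePDF y Sp) u =
          (∑ y ∈ t k, (w k y : ℝ) * gaussPDF y ((n : ℝ)⁻¹ • Sp) (sampleMean u)) * R u := by
        rw [Finset.sum_apply, Finset.sum_mul]
        refine Finset.sum_congr rfl fun y _ => ?_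
        rw [Pi.smul_apply, hR, NNReal.smul_def, smul_eq_mul, mul_assoc]
      dsimp only
      rw [hsum, hg, Real.log_mul hpos.ne' (hR0 u).ne',
        Real.log_mul (gaussPDF_pos m h0 _).ne' (hR0 u).ne']
      ring
  obtain ⟨hrip, P, hP, hPt⟩ := isRIPr_of_dominated (measurable_samplePDF m Sq)
    (samplePDF_pos m hq) (gaussSample_eq_withDensity m hq) (integrable_log_samplePDF m m hq Sq)
    hgm hg0 hg1 hgl hC happ
  exact ⟨hrip, fun g' hg' => IsRIPr.ae_eq hg' hrip hP hPt⟩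

theorem integral_log_ripVar_div_uiVar (hn : 1 ≤ n) (m : EuclideanSpace ℝ (Fin d))
    {Sp Sq S₀ : Matrix (Fin d) (Fin d) ℝ} (hp : Sp.PosDef) (hq : Sq.PosDef) (h0 : S₀.PosDef)
    {R : (Fin n → EuclideanSpace ℝ (Fin d)) → ℝ} (hR0 : ∀ u, 0 < R u)
    (hR : ∀ μ u, samplePDF μ Sp u = gaussPDF μ ((n : ℝ)⁻¹ • Sp) (sampleMean u) * R u)
    {g : (Fin n → EuclideanSpace ℝ (Fin d)) → ℝ}
    (hg : g =ᵐ[gaussSample n m Sq] fun u => gaussPDF m S₀ (sampleMean u) * R u) :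
    Integrable (fun u => Real.log (ripVar m Sq g u / uiVar m Sp Sq u)) (gaussSample n m Sq) ∧
      ∫ u, Real.log (ripVar m Sq g u / uiVar m Sp Sq u) ∂gaussSample n m Sq =
        (Real.log S₀.det - Real.log ((n : ℝ)⁻¹ • Sp).det) / 2 +
          ((n : ℝ)⁻¹ • Sq * S₀⁻¹).trace / 2 := by
  have hn0 : (0 : ℝ) < n := by exact_mod_cast hn
  have hp' : ((n : ℝ)⁻¹ • Sp).PosDef := hp.smul (by positivity)
  have hq' : ((n : ℝ)⁻¹ • Sq).PosDef := hq.smul (by positivity)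
  set f : EuclideanSpace ℝ (Fin d) → ℝ := fun x =>
    (Real.log S₀.det - Real.log ((n : ℝ)⁻¹ • Sp).det) / 2 +
      ((x - m).ofLp ⬝ᵥ S₀⁻¹ *ᵥ (x - m).ofLp) / 2 with hf
  -- The quadratic form is an affine function of `log (gaussPDF m S₀ x)`, whose measurability is
  -- known.
  have hfm : Measurable f := by
    have : f = fun x => Real.log S₀.det / 2 - Real.log ((n : ℝ)⁻¹ • Sp).det / 2 -
        Real.log (gaussPDF m S₀ x) -
          ((d : ℝ) * Real.log (2 * Real.pi) + Real.log S₀.det) / 2 := by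
      ext x
      rw [hf, log_gaussPDF m h0]
      ring
    rw [this]
    exact ((measurable_gaussPDF m S₀).log.const_sub _).sub_const _
  have hae : (fun u => Real.log (ripVar m Sq g u / uiVar m Sp Sq u)) =ᵐ[gaussSample n m Sq]
      fun u => f (sampleMean u) := by
    filter_upwards [hg] with u hu
    have hs := samplePDF_pos m hq u
    have h1 := gaussPDF_pos m h0 (sampleMean u)
    have h2 := gaussPDF_pos (sampleMean u) hp' (sampleMean u)
    -- The density of `Q^n` and the factor `R` cancel; the numerator is a Gaussian density at its
    -- own centre, hence a constant.
    have : ripVar m Sq g u / uiVar m Sp Sq u =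
        gaussPDF (sampleMean u) ((n : ℝ)⁻¹ • Sp) (sampleMean u) /
          gaussPDF m S₀ (sampleMean u) := by
      rw [ripVar, uiVar, iSup_samplePDF hn hp, hR, hu]
      have := hR0 u
      field_simp
    rw [this, Real.log_div h2.ne' h1.ne', log_gaussPDF _ hp', log_gaussPDF _ h0, hf]
    simp
    ring
  obtain ⟨hqI, hqv⟩ := integral_quadForm_multivariateGaussian m hq'.posSemidef S₀⁻¹
  have hfI : Integrable f (multivariateGaussian m ((n : ℝ)⁻¹ • Sq)) :=
    (integrable_const _).add (hqI.div_const 2)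
  refine ⟨(integrable_comp_sampleMean hn m hq.posSemidef hfm hfI).congr hae.symm, ?_⟩
  have e : ∫ x, f x ∂multivariateGaussian m ((n : ℝ)⁻¹ • Sq) =
      ∫ _, (Real.log S₀.det - Real.log ((n : ℝ)⁻¹ • Sp).det) / 2
        ∂multivariateGaussian m ((n : ℝ)⁻¹ • Sq) +
      ∫ x, ((x - m).ofLp ⬝ᵥ S₀⁻¹ *ᵥ (x - m).ofLp) / 2
        ∂multivariateGaussian m ((n : ℝ)⁻¹ • Sq) :=
    integral_add (integrable_const _) (hqI.div_const 2)
  have e' : ∫ x, ((x - m).ofLp ⬝ᵥ S₀⁻¹ *ᵥ (x - m).ofLp) / 2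
      ∂multivariateGaussian m ((n : ℝ)⁻¹ • Sq) = ((n : ℝ)⁻¹ • Sq * S₀⁻¹).trace / 2 := by
    rw [← hqv]
    exact integral_div _ _
  rw [integral_congr_ae hae, integral_comp_sampleMean hn m hq.posSemidef hfm, e, e',
    integral_const, probReal_univ, one_smul]

end Projection

/-! ### Spectrum of the whitened covariance -/

section Eigenvalues

variable {d : ℕ} {Sp Sq : Matrix (Fin d) (Fin d) ℝ}

theorem trace_whitened (hp : Sp.PosDef) (Sq : Matrix (Fin d) (Fin d) ℝ) :
    (whitened Sp Sq).trace = effDim Sq Sp := by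
  rw [whitened, Matrix.mul_assoc, Matrix.trace_mul_comm, Matrix.mul_assoc,
    inv_sqrt_mul_inv_sqrt hp, effDim]

theorem det_whitened (hp : Sp.PosDef) (Sq : Matrix (Fin d) (Fin d) ℝ) :
    (whitened Sp Sq).det = Sq.det / Sp.det := by
  rw [whitened, Matrix.det_mul, Matrix.det_mul, mul_right_comm, ← Matrix.det_mul,
    inv_sqrt_mul_inv_sqrt hp, Matrix.det_nonsing_inv, Ring.inverse_eq_inv']
  ring

open scoped MatrixOrder in
theorem whitened_sub (Sp Sq Sr : Matrix (Fin d) (Fin d) ℝ) :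
    whitened Sp Sq - whitened Sp Sr = whitened Sp (Sq - Sr) := by
  simp only [whitened, Matrix.mul_sub, Matrix.sub_mul]

open scoped MatrixOrder in
theorem whitened_self (hp : Sp.PosDef) : whitened Sp Sp = 1 := by
  have h := isUnit_det_sqrt hp
  rw [whitened]
  nth_rw 2 [← CFC.sqrt_mul_sqrt_self Sp hp.posSemidef.nonneg]
  rw [← Matrix.mul_assoc, Matrix.nonsing_inv_mul _ h, Matrix.one_mul, Matrix.mul_nonsing_inv _ h]

open scoped MatrixOrder in
theorem posDef_whitened (hp : Sp.PosDef) {A : Matrix (Fin d) (Fin d) ℝ} (hA : A.PosDef) :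
    (whitened Sp A).PosDef := by
  have hR : ((CFC.sqrt Sp)⁻¹).IsHermitian :=
    Matrix.IsHermitian.inv (CFC.sqrt_nonneg Sp).isSelfAdjoint
  have hu : IsUnit (CFC.sqrt Sp)⁻¹ :=
    (Matrix.isUnit_nonsing_inv_iff).2 ((Matrix.isUnit_iff_isUnit_det _).2 (isUnit_det_sqrt hp))
  have h := hA.conjTranspose_mul_mul_same (Matrix.mulVec_injective_of_isUnit hu)
  rwa [hR.eq] at h

theorem sum_eigenvalues_whitened (hp : Sp.PosDef) (hq : Sq.PosDef) :
    ∑ j, (whitened_isHermitian Sp hq).eigenvalues j = effDim Sq Sp := by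
  rw [← trace_whitened hp, (whitened_isHermitian Sp hq).trace_eq_sum_eigenvalues]
  simp

theorem sum_log_eigenvalues_whitened (hp : Sp.PosDef) (hq : Sq.PosDef) :
    ∑ j, Real.log ((whitened_isHermitian Sp hq).eigenvalues j) =
      Real.log Sq.det - Real.log Sp.det := by
  rw [← Real.log_div hq.det_pos.ne' hp.det_pos.ne', ← det_whitened hp,
    (whitened_isHermitian Sp hq).det_eq_prod_eigenvalues, ← Real.log_prod]
  · simp
  · exact fun j _ => ((posDef_whitened hp hq).eigenvalues_pos j).ne'

/-- Whitening is a congruence sending `Sp` to the identity, so `whitened Sp Sq - 1` is positive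
definite; its quadratic form at an eigenvector `v` is `(λ - 1) v ⬝ᵥ v`. -/
theorem one_lt_eigenvalues_whitened (hp : Sp.PosDef) (hq : Sq.PosDef) (h : (Sq - Sp).PosDef)
    (j : Fin d) : 1 < (whitened_isHermitian Sp hq).eigenvalues j := by
  set hH := whitened_isHermitian Sp hq
  have hW : (whitened Sp Sq - 1).PosDef := by
    rw [← whitened_self hp, whitened_sub]
    exact posDef_whitened hp h
  set v := (hH.eigenvectorBasis j).ofLp with hv
  have hv0 : v ≠ 0 := by
    intro h0
    have h1 : hH.eigenvectorBasis j = 0 := by ext i; exact congrFun h0 i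
    exact hH.eigenvectorBasis.orthonormal.ne_zero j h1
  have hpos := hW.dotProduct_mulVec_pos hv0
  have hvv : 0 < v ⬝ᵥ v := by
    have := Matrix.dotProduct_star_self_pos_iff.2 hv0
    simpa using this
  rw [Matrix.sub_mulVec, Matrix.one_mulVec, hH.mulVec_eigenvectorBasis, dotProduct_sub,
    dotProduct_smul, star_trivial, ← hv] at hpos
  simp only [smul_eq_mul] at hpos
  nlinarith

theorem effDim_lt (hd : 1 ≤ d) (hp : Sp.PosDef) (h : (Sp - Sq).PosDef) :
    effDim Sq Sp < d := by
  have : Nonempty (Fin d) := ⟨⟨0, hd⟩⟩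
  have hpos := (posDef_whitened hp h).trace_pos
  rw [← whitened_sub, whitened_self hp, Matrix.trace_sub, Matrix.trace_one,
    trace_whitened hp, Fintype.card_fin] at hpos
  linarith

/-- `gaussDiv` vanishes at `Sq * Sq⁻¹ = 1`, and the trace in the other term cancels `effDim Sq Sp /
2`. -/
theorem effDim_sub_covDiv (hp : Sp.PosDef) (hq : Sq.PosDef) :
    effDim Sq Sp / 2 - covDiv Sq Sq Sp =
      (d : ℝ) / 2 + (1 / 2) * (Real.log Sq.det - Real.log Sp.det) := by
  have h1 : (Sq * Sp⁻¹).det = Sq.det / Sp.det := by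
    rw [Matrix.det_mul, Matrix.det_nonsing_inv, Ring.inverse_eq_inv']; rfl
  rw [covDiv, gaussDiv, gaussDiv, effDim, h1, Matrix.mul_nonsing_inv _ hq.det_pos.ne'.isUnit,
    Real.log_div hq.det_pos.ne' hp.det_pos.ne']
  simp
  ring

end Eigenvalues

/-! ### The e-power gap in the two cases -/

section Gap

variable {d n : ℕ} {Sp Sq : Matrix (Fin d) (Fin d) ℝ}

theorem log_det_smul_sub (hn : 1 ≤ n) (hp : Sp.PosDef) (hq : Sq.PosDef) :
    Real.log ((n : ℝ)⁻¹ • Sq).det - Real.log ((n : ℝ)⁻¹ • Sp).det =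
      Real.log Sq.det - Real.log Sp.det := by
  have hn0 : (0 : ℝ) < n := by exact_mod_cast hn
  rw [Matrix.det_smul, Matrix.det_smul, Real.log_mul (by positivity) hq.det_pos.ne',
    Real.log_mul (by positivity) hp.det_pos.ne']
  ring

theorem smul_mul_inv_smul (hn : 1 ≤ n) (A : Matrix (Fin d) (Fin d) ℝ) (hp : Sp.PosDef) :
    (n : ℝ)⁻¹ • A * ((n : ℝ)⁻¹ • Sp)⁻¹ = A * Sp⁻¹ := by
  have hn0 : (n : ℝ) ≠ 0 := by exact_mod_cast (by omega : n ≠ 0)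
  rw [inv_smul_inv_natCast hn hp, Matrix.smul_mul, Matrix.mul_smul, inv_smul_smul₀ hn0]

/-- Here `S₀ = Sq/n`: the mixing covariance `(Sq - Sp)/n` fills the gap between `Sp/n` and `Sq/n`,
and the trace term becomes `d / 2`. -/
theorem ePowerGapEq_antiSimple (hn : 1 ≤ n) (m : EuclideanSpace ℝ (Fin d)) (hp : Sp.PosDef)
    (hq : Sq.PosDef) (h : (Sq - Sp).PosDef) :
    EPowerGapEq n m Sp Sq (effDim Sq Sp / 2 - covDiv Sq Sq Sp) := by
  have hn0 : (0 : ℝ) < n := by exact_mod_cast hn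
  have hp' : ((n : ℝ)⁻¹ • Sp).PosDef := hp.smul (by positivity)
  have hq' : ((n : ℝ)⁻¹ • Sq).PosDef := hq.smul (by positivity)
  have hT : ((n : ℝ)⁻¹ • (Sq - Sp)).PosSemidef := h.posSemidef.smul (by positivity)
  have hsum : (n : ℝ)⁻¹ • (Sq - Sp) + (n : ℝ)⁻¹ • Sp = (n : ℝ)⁻¹ • Sq := by
    rw [← smul_add, sub_add_cancel]
  obtain ⟨R, hRm, hR0, hR⟩ := exists_samplePDF_eq_mul hn hp
  have ht := tendsto_integral_log_approxMix m hp' hT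
  rw [hsum] at ht
  simp_rw [approxMix_eq_sum _ hp'] at ht
  obtain ⟨h1, h2⟩ := isGaussRIPr_gaussPDF_mul hn m hp hq hq' hRm hR0 hR
    (fun μ => (lintegral_gaussPDF_div_self μ m hp' hq').le) _ _
    (sum_measure_preimage_approxId _) ht
  refine ⟨⟨_, h1⟩, fun g hg => ?_⟩
  obtain ⟨hI, hval⟩ := integral_log_ripVar_div_uiVar hn m hp hq hq' hR0 hR (h2 g hg)
  refine ⟨hI, hval.trans ?_⟩
  rw [log_det_smul_sub hn hp hq, smul_mul_inv_smul hn Sq hq,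
    Matrix.mul_nonsing_inv _ hq.det_pos.ne'.isUnit, effDim_sub_covDiv hp hq, Matrix.trace_one,
    Fintype.card_fin]
  ring

/-- Here `S₀ = Sp/n`: the point mass at `m` already attains the infimum, so the approximating
sequence is constant and the log-determinants cancel. -/
theorem ePowerGapEq_simple (hn : 1 ≤ n) (m : EuclideanSpace ℝ (Fin d)) (hp : Sp.PosDef)
    (hq : Sq.PosDef) (h : (Sp - Sq).PosDef) :
    EPowerGapEq n m Sp Sq (effDim Sq Sp / 2) := by
  have hn0 : (0 : ℝ) < n := by exact_mod_cast hn
  have hp' : ((n : ℝ)⁻¹ • Sp).PosDef := hp.smul (by positivity)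
  have hq' : ((n : ℝ)⁻¹ • Sq).PosDef := hq.smul (by positivity)
  have hT : ((n : ℝ)⁻¹ • Sp - (n : ℝ)⁻¹ • Sq).PosSemidef := by
    rw [← smul_sub]
    exact h.posSemidef.smul (by positivity)
  obtain ⟨R, hRm, hR0, hR⟩ := exists_samplePDF_eq_mul hn hp
  obtain ⟨h1, h2⟩ := isGaussRIPr_gaussPDF_mul hn m hp hq hp' hRm hR0 hR
    (fun μ => lintegral_gaussPDF_div_le_one μ m hp' hq'.posSemidef hT) (fun _ => {m})
    (fun _ _ => 1) (fun _ => by simp) (by simp)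
  refine ⟨⟨_, h1⟩, fun g hg => ?_⟩
  obtain ⟨hI, hval⟩ := integral_log_ripVar_div_uiVar hn m hp hq hp' hR0 hR (h2 g hg)
  refine ⟨hI, hval.trans ?_⟩
  rw [smul_mul_inv_smul hn Sq hp, sub_self, effDim]
  ring

end Gap

end EPower

theorem mainTheorem7 (d : ℕ) (hd : 1 ≤ d) (m : EuclideanSpace ℝ (Fin d))
    (Sp Sq : Matrix (Fin d) (Fin d) ℝ) (hp : Sp.PosDef) (hq : Sq.PosDef) :
    ((Sq - Sp).PosDef →
      (∀ n : ℕ, 1 ≤ n → EPower.EPowerGapEq n m Sp Sq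
        (EPower.effDim Sq Sp / 2 - EPower.covDiv Sq Sq Sp)) ∧
      EPower.effDim Sq Sp / 2 - EPower.covDiv Sq Sq Sp =
        (d : ℝ) / 2 + (1 / 2) *
          ∑ j, Real.log ((EPower.whitened_isHermitian Sp hq).eigenvalues j) ∧
      (d : ℝ) / 2 + (1 / 2) *
          ∑ j, Real.log ((EPower.whitened_isHermitian Sp hq).eigenvalues j) > (d : ℝ) / 2) ∧
    ((Sp - Sq).PosDef →
      (∀ n : ℕ, 1 ≤ n → EPower.EPowerGapEq n m Sp Sq (EPower.effDim Sq Sp / 2)) ∧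
      EPower.effDim Sq Sp = ∑ j, (EPower.whitened_isHermitian Sp hq).eigenvalues j ∧
      EPower.effDim Sq Sp / 2 < (d : ℝ) / 2) := by
  refine ⟨fun h => ⟨fun n hn => EPower.ePowerGapEq_antiSimple hn m hp hq h, ?_, ?_⟩,
    fun h => ⟨fun n hn => EPower.ePowerGapEq_simple hn m hp hq h,
      (EPower.sum_eigenvalues_whitened hp hq).symm, ?_⟩⟩
  · rw [EPower.effDim_sub_covDiv hp hq, EPower.sum_log_eigenvalues_whitened hp hq]
  · have hpos : 0 < ∑ j, Real.log ((EPower.whitened_isHermitian Sp hq).eigenvalues j) :=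
      Finset.sum_pos (fun j _ => Real.log_pos (EPower.one_lt_eigenvalues_whitened hp hq h j))
        ⟨⟨0, hd⟩, Finset.mem_univ _⟩
    linarith
  · linarith [EPower.effDim_lt hd hp h]
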